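/- Let $\mathcal H$ be a separable complex Hilbert space, $g\in C^1(\mathbb R)$ real-valued with $\operatorname{supp} g'\subset(0,1)$ and $g(s)=0$ for $s<0$, and set $M=\max_{[0,1]}|g|$, $M'=\max_{[0,1]}|g'|$. Let $H_0$ be self-adjoint with $H_0\ge 1+\gamma_0$ for some $\gamma_0>0$, and let $H_1$ be self-adjoint and $H_0^{1/2}$-bounded, i.e. $D(H_0^{1/2})\subseteq D(H_1)$ and, for some $a,b\ge 0$, $$\|H_1\psi\|\le a\|H_0^{1/2}\psi\|+b\|\psi\|\qquad(\psi\in D(H_0^{1/2})).$$ Let $\varepsilon_*>0$ satisfy $\frac{3\gamma_0+1}{\gamma_0}\,\varepsilon_* M\,\|H_1H_0^{-1}\|<1$ and put $H(\varepsilon,\eta,t)=H_0+\varepsilon g(\eta t)H_1$ for $\varepsilon\in(0,\varepsilon_*]$, $\eta>0$, $t\in\mathbb R$ (these operators are self-adjoint on $D(H_0)$ and $\ge 1$). Let $n\in\mathbb Z$. If $n\neq 0$, assume that the commutator $[H_1,H_0]$ is a linear operator with $D([H_1,H_0])\supseteq D(H_0^{1/2})$ and $$\langle\varphi,[H_1,H_0]\psi\rangle=\langle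 H_1\varphi,H_0\psi\rangle-\langle H_0\varphi,H_1\psi\rangle\qquad(\varphi,\psi\in D(H_0)),$$ and that there are constants $E_k$ such that for every integer $k$ with $-|n|\le k\le -1$ $$\|H^{k/2}(\varepsilon,\eta,t)\,[H_1,H_0]\,H^{-(k+2)/2}(\varepsilon,\eta,t)\|\le E_k\qquad\text{for all }\varepsilon\in(0,\varepsilon_*],\ \eta>0,\ t\in\mathbb R .$$ For $\varepsilon\in(0,\varepsilon_*]$ and $\eta>0$ let $U_{\varepsilon,\eta}(t,r)$ be the unitary propagator generated by $H(\varepsilon,\eta,\cdot)$: a jointly strongly continuous family of unitary operators such that, for all $t,r,u\in\mathbb R$, $U(t,r)U(r,u)=U(t,u)$, $U(t,t)=1$, $U(t,u)D(H_0)=D(H_0)$ and, for $\psi\in D(H_0)$, $i\partial_tU(t,u)\psi=H(\varepsilon,\eta,t)U(t,u)\psi$ and $i\partial_uU(t,u)\psi=-U(t,u)H(\varepsilon,\eta,u)\psi$. Then for every $\varepsilon\in(0,\varepsilon_*]$ and $\eta>0$ the operator $H^{-n/2}(\varepsilon,\eta,t)\,U_{\varepsilon,\eta}(t,r)\,H^{n/2}(\varepsilon,\eta,r)$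 is densely defined and bounded for all $t,r\in\mathbb R$, and $$\sup_{t,r\in\mathbb R}\big\|H^{-n/2}(\varepsilon,\eta,t)\,U_{\varepsilon,\eta}(t,r)\,H^{n/2}(\varepsilon,\eta,r)\big\|\le C_{|n|}(\varepsilon),$$ where $C_0(\varepsilon)=1$ and, for $m\ge 1$, $$C_m(\varepsilon)=C_{m-1}(\varepsilon)\exp\!\big(C_{m-1}(\varepsilon)\,(\alpha+\beta\varepsilon+\gamma_m)\,\varepsilon\big),$$ $$\alpha=M'(a+b),\qquad \beta=3\,a\,M\,M'\,\|H_1H_0^{-1/2}\|,\qquad \gamma_m=M'\sum_{k=1}^mE_{-k}.$$ -/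

import Mathlib

open scoped InnerProductSpace

noncomputable section

namespace EnergyEstimate

variable {𝓗 : Type*} [NormedAddCommGroup 𝓗] [InnerProductSpace ℂ 𝓗] [CompleteSpace 𝓗]

/-! ### Unbounded operators -/

/-- The composition `S ∘ T` of two partially defined operators on its natural domain
`{ψ ∈ D(T) : T ψ ∈ D(S)}`. -/
def pcomp (S T : 𝓗 →ₗ.[ℂ] 𝓗) : 𝓗 →ₗ.[ℂ] 𝓗 where
  domain :=
    { carrier := {ψ | ∃ h : ψ ∈ T.domain, T ⟨ψ, h⟩ ∈ S.domain}
      zero_mem' := ⟨T.domain.zero_mem, by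
        have : T ⟨0, T.domain.zero_mem⟩ = 0 := T.map_zero
        rw [this]; exact S.domain.zero_mem⟩
      add_mem' := by
        rintro x y ⟨hx, hx'⟩ ⟨hy, hy'⟩
        refine ⟨T.domain.add_mem hx hy, ?_⟩
        have : T ⟨x + y, T.domain.add_mem hx hy⟩ = T ⟨x, hx⟩ + T ⟨y, hy⟩ :=
          T.map_add ⟨x, hx⟩ ⟨y, hy⟩
        rw [this]; exact S.domain.add_mem hx' hy'
      smul_mem' := by
        rintro c x ⟨hx, hx'⟩
        refine ⟨T.domain.smul_mem c hx, ?_⟩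
        have : T ⟨c • x, T.domain.smul_mem c hx⟩ = c • T ⟨x, hx⟩ := T.map_smul c ⟨x, hx⟩
        rw [this]; exact S.domain.smul_mem c hx' }
  toFun :=
    { toFun := fun ψ => S ⟨T ⟨ψ, ψ.2.1⟩, ψ.2.2⟩
      map_add' := by
        intro x y
        rw [← S.map_add]
        congr 1
        exact Subtype.ext (T.map_add ⟨x, x.2.1⟩ ⟨y, y.2.1⟩)
      map_smul' := by
        intro c x
        rw [RingHom.id_apply, ← S.map_smul]
        congr 1
        exact Subtype.ext (T.map_smul c ⟨x, x.2.1⟩) }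

/-- A bounded operator, regarded as a partially defined operator with domain `𝓗`. -/
def ofBounded (B : 𝓗 →L[ℂ] 𝓗) : 𝓗 →ₗ.[ℂ] 𝓗 := (B : 𝓗 →ₗ[ℂ] 𝓗).toPMap ⊤

/-- `T` is densely defined and bounded with `‖T‖ ≤ C` (so that its closure is an everywhere
defined bounded operator of norm at most `C`). -/
def NormLE (T : 𝓗 →ₗ.[ℂ] 𝓗) (C : ℝ) : Prop :=
  Dense (T.domain : Set 𝓗) ∧ ∀ ψ : T.domain, ‖T ψ‖ ≤ C * ‖(ψ : 𝓗)‖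

/-- The operator norm of a bounded, partially defined operator. -/
def pnorm (T : 𝓗 →ₗ.[ℂ] 𝓗) : ℝ :=
  sInf {c : ℝ | 0 ≤ c ∧ ∀ ψ : T.domain, ‖T ψ‖ ≤ c * ‖(ψ : 𝓗)‖}

/-- `B` is the bounded, everywhere defined inverse of `T : D(T) → 𝓗`. -/
def IsBoundedInverse (T : 𝓗 →ₗ.[ℂ] 𝓗) (B : 𝓗 →L[ℂ] 𝓗) : Prop :=
  (∀ φ : 𝓗, ∃ h : B φ ∈ T.domain, T ⟨B φ, h⟩ = φ) ∧ ∀ ψ : T.domain, B (T ψ) = ψ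

open Classical in
/-- The bounded inverse `T⁻¹` (it is unique, and exists for instance when `T` is self-adjoint
with `T ≥ c > 0`; the value is `0` if there is none). -/
def boundedInverse (T : 𝓗 →ₗ.[ℂ] 𝓗) : 𝓗 →L[ℂ] 𝓗 :=
  if h : ∃ B : 𝓗 →L[ℂ] 𝓗, IsBoundedInverse T B then h.choose else 0

/-- For a self-adjoint operator `T ≥ c > 0`: the bounded operator `T^{-m/2}`, namely the `m`-th
power of the positive square root of `T⁻¹`. -/
def negHalfPow (T : 𝓗 →ₗ.[ℂ] 𝓗) (m : ℕ) : 𝓗 →L[ℂ] 𝓗 :=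
  CFC.sqrt (boundedInverse T) ^ m

/-- For a self-adjoint operator `T ≥ c > 0` and `k ∈ ℤ`: the operator `T^{k/2}` on its natural
domain. For `k = m ≥ 0` it is the inverse of `T^{-m/2}`, with domain the range of `T^{-m/2}`;
for `k < 0` it is bounded and everywhere defined. -/
def halfPow (T : 𝓗 →ₗ.[ℂ] 𝓗) : ℤ → (𝓗 →ₗ.[ℂ] 𝓗)
  | Int.ofNat m => (ofBounded (negHalfPow T m)).inverse
  | Int.negSucc m => ofBounded (negHalfPow T (m + 1))

/-- `A` is `S`-bounded, with constants `a` and `b`. -/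
def RelBounded (A S : 𝓗 →ₗ.[ℂ] 𝓗) (a b : ℝ) : Prop :=
  ∃ h : S.domain ≤ A.domain, ∀ ψ : S.domain,
    ‖A ⟨ψ, h ψ.2⟩‖ ≤ a * ‖S ψ‖ + b * ‖(ψ : 𝓗)‖

/-- The operator `K` is the commutator `[H₁, H₀] = H₁ H₀ - H₀ H₁`, extended to (at least)
`D(H₀^{1/2})`. In general `H₀` need not map its domain into `D(H₁)`, nor `H₁` map `D(H₀)` into
itself, so the commutator is taken in the sense of sesquilinear forms on `D(H₀)`. -/
def IsCommutator (H₁ H₀ K : 𝓗 →ₗ.[ℂ] 𝓗) : Prop :=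
  (halfPow H₀ 1).domain ≤ K.domain ∧
  ∃ (h₁ : H₀.domain ≤ H₁.domain) (hK : H₀.domain ≤ K.domain), ∀ φ ψ : H₀.domain,
    ⟪(φ : 𝓗), K ⟨ψ, hK ψ.2⟩⟫_ℂ =
      ⟪H₁ ⟨φ, h₁ φ.2⟩, H₀ ψ⟫_ℂ - ⟪H₀ φ, H₁ ⟨ψ, h₁ ψ.2⟩⟫_ℂ

/-! ### The time-dependent Hamiltonian and its propagator -/

/-- The Hamiltonian `H(ε, η, t) = H₀ + ε g(η t) H₁` on `D(H₀) ∩ D(H₁)`. -/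
def hamiltonian (H₀ H₁ : 𝓗 →ₗ.[ℂ] 𝓗) (g : ℝ → ℝ) (ε η t : ℝ) : 𝓗 →ₗ.[ℂ] 𝓗 :=
  H₀ + ((ε * g (η * t) : ℝ) : ℂ) • H₁

/-- `U` is the unitary propagator generated by the operators `A t`, on the time-independent
domain `D`. -/
structure IsUnitaryPropagator (A : ℝ → (𝓗 →ₗ.[ℂ] 𝓗)) (D : Submodule ℂ 𝓗)
    (U : ℝ → ℝ → (𝓗 →L[ℂ] 𝓗)) : Prop where
  unitary_mem : ∀ t r, U t r ∈ unitary (𝓗 →L[ℂ] 𝓗)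
  continuous : ∀ ψ : 𝓗, Continuous fun p : ℝ × ℝ => U p.1 p.2 ψ
  comp : ∀ t r u, U t r ∘L U r u = U t u
  self : ∀ t, U t t = ContinuousLinearMap.id ℂ 𝓗
  map_domain : ∀ t u, D.map (U t u : 𝓗 →ₗ[ℂ] 𝓗) = D
  hasDerivAt_left : ∀ t u, ∀ ψ ∈ D, ∃ h : U t u ψ ∈ (A t).domain,
    HasDerivAt (fun s => U s u ψ) (-Complex.I • A t ⟨U t u ψ, h⟩) t
  hasDerivAt_right : ∀ t u, ∀ ψ ∈ D, ∃ h : ψ ∈ (A u).domain,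
    HasDerivAt (fun s => U t s ψ) (Complex.I • U t u (A u ⟨ψ, h⟩)) u

/-- The commutator assumption of order `k` with constant `E`: `K` is the commutator `[H₁, H₀]`
and `‖H^{k/2} K H^{-(k+2)/2}‖ ≤ E` for `H = H(ε, η, t)`, uniformly in `ε ∈ (0, εs]`, `η > 0`
and `t`. -/
def CommutatorBound (H₀ H₁ K : 𝓗 →ₗ.[ℂ] 𝓗) (g : ℝ → ℝ) (εs : ℝ) (k : ℤ) (E : ℝ) : Prop :=
  IsCommutator H₁ H₀ K ∧ ∀ ε η t : ℝ, 0 < ε → ε ≤ εs → 0 < η →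
    NormLE (pcomp (halfPow (hamiltonian H₀ H₁ g ε η t) k)
      (pcomp K (halfPow (hamiltonian H₀ H₁ g ε η t) (-(k + 2))))) E

/-! ### The constants -/

/-- `M = max_{s ∈ [0,1]} |g s|`. -/
def maxAbs (g : ℝ → ℝ) : ℝ := sSup ((fun s => |g s|) '' Set.Icc 0 1)

/-- `α = M' (a + b)`, with `M' = max_{[0,1]} |g'|`. -/
def alphaConst (g : ℝ → ℝ) (a b : ℝ) : ℝ := maxAbs (deriv g) * (a + b)

/-- `β = 3 a M M' ‖H₁ H₀^{-1/2}‖`. -/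
def betaConst (H₀ H₁ : 𝓗 →ₗ.[ℂ] 𝓗) (g : ℝ → ℝ) (a : ℝ) : ℝ :=
  maxAbs (deriv g) * (3 * a * maxAbs g * pnorm (pcomp H₁ (halfPow H₀ (-1))))

/-- `γ_n = M' (E_{-1} + ⋯ + E_{-n})`. -/
def gammaConst (g : ℝ → ℝ) (E : ℤ → ℝ) (n : ℕ) : ℝ :=
  maxAbs (deriv g) * ∑ k ∈ Finset.Icc 1 n, E (-(k : ℤ))

/-- `C_0 = 1` and `C_n = C_{n-1} exp (C_{n-1} (α + β ε + γ_n) ε)` for `n ≥ 1`. -/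
def energyConst (α β : ℝ) (γ : ℕ → ℝ) (ε : ℝ) : ℕ → ℝ
  | 0 => 1
  | n + 1 => energyConst α β γ ε n *
      Real.exp (energyConst α β γ ε n * (α + β * ε + γ (n + 1)) * ε)

end EnergyEstimate

end

/-!
The operator `H(t)^{-m/2} U(t, r) H(r)^{m/2}` is bounded by `C` exactly when
`‖H(t)^{-m/2} U(t, r) x‖ ≤ C ‖H(r)^{-m/2} x‖` for all `x`, and by duality
(`IsUnitaryPropagator.normLE`) this inequality, for all times, also covers the opposite power. Thus
only the bounded operators `B(t) = H(t)^{-1/2}` and `R(t) = B(t)² = H(t)⁻¹` are needed.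

For `u(t) = U(t, r) x` with `x` in the domain, put `F(t) = ‖B(t)^m u(t)‖² = ⟪u(t), R(t)^m u(t)⟫`. The
generator commutes with `R(t)^m`, so `F'` is the form of the derivative of `R(t)^m` alone. Since
`R' = -ε η g'(η t) R H₁ R`, this is a sum of terms `R^(j+1) H₁ R^(m-j)`. Moving `H₁` through
resolvents with `[H₁, R] = -R K R` and the commutator bounds brings each term to one that is
controlled by `‖H₁ ψ‖ ≤ A ‖H^{1/2} ψ‖`, with `A = a + b + 3 a ε M ‖H₁ H₀^{-1/2}‖`
(`FormBounds.norm_inner_le`, `FormBounds.exists_hasDerivAt_pow`). The outcome is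
`|F'| ≤ 2 ε |η g'(η t)| (S₀ + ⋯ + S_{m-1}) F` with `S_j = A + E_{-1} + ⋯ + E_{-j}`. As `g'` lives on
`[0, 1]`, integrating the logarithmic derivative costs at most `max |g'|`, whatever `η` is
(`le_exp_mul_of_abs_deriv_le`), so that `‖B(t)^m u(t)‖ ≤ exp (ε M' (S₀ + ⋯ + S_{m-1})) ‖B(r)^m x‖`.
This factor is at most `C_m(ε)` because every `C_j(ε)` is at least `1` (`exp_sum_le_energyConst`).

On the side of the unbounded operators, `H(t) = (1 + c H₁ H₀⁻¹) H₀` has a bounded inverse by a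
Neumann series. The lower bound `H(t) ≥ 1` needs the form bound
`|c ⟪ψ, H₁ ψ⟫| ≤ ‖c H₁ H₀⁻¹‖ ⟪ψ, H₀ ψ⟫`, a comparison of spectral radii
(`PerturbationData.norm_smul_mul_le`).
-/

namespace EnergyEstimate

section

variable {𝓗 : Type*} [NormedAddCommGroup 𝓗] [InnerProductSpace ℂ 𝓗]

/-! ### Compositions, norms and inverses -/

/-- The infimum in the definition of the operator norm is attained. -/
theorem norm_apply_le_pnorm {T : 𝓗 →ₗ.[ℂ] 𝓗} {c : ℝ} (hc : 0 ≤ c)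
    (h : ∀ ψ : T.domain, ‖T ψ‖ ≤ c * ‖(ψ : 𝓗)‖) (ψ : T.domain) :
    ‖T ψ‖ ≤ pnorm T * ‖(ψ : 𝓗)‖ := by
  rcases eq_or_lt_of_le (norm_nonneg (ψ : 𝓗)) with h0 | h0
  · have := h ψ
    rw [← h0, mul_zero] at this ⊢
    exact this
  · rw [← div_le_iff₀ h0]
    refine le_csInf ⟨c, hc, h⟩ ?_
    rintro d ⟨-, hd⟩
    rw [div_le_iff₀ h0]
    exact hd ψ

theorem pnorm_nonneg (T : 𝓗 →ₗ.[ℂ] 𝓗) : 0 ≤ pnorm T :=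
  Real.sInf_nonneg fun _ h => h.1

theorem mem_pcomp_domain {S T : 𝓗 →ₗ.[ℂ] 𝓗} {x y z : 𝓗}
    (hx : ∃ h : x ∈ T.domain, T ⟨x, h⟩ = y) (hy : ∃ h : y ∈ S.domain, S ⟨y, h⟩ = z) :
    ∃ h : x ∈ (pcomp S T).domain, pcomp S T ⟨x, h⟩ = z := by
  obtain ⟨h, rfl⟩ := hx
  obtain ⟨h', rfl⟩ := hy
  exact ⟨⟨h, h'⟩, rfl⟩

theorem ofBounded_apply (B : 𝓗 →L[ℂ] 𝓗) (x : 𝓗) :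
    ∃ h : x ∈ (ofBounded B).domain, ofBounded B ⟨x, h⟩ = B x :=
  ⟨Submodule.mem_top, rfl⟩

theorem inverse_ofBounded_domain (B : 𝓗 →L[ℂ] 𝓗) (y : 𝓗) :
    y ∈ (ofBounded B).inverse.domain ↔ ∃ x, B x = y := by
  rw [LinearPMap.inverse_domain]
  constructor
  · rintro ⟨x, hx⟩
    exact ⟨x, hx⟩
  · rintro ⟨x, hx⟩
    exact ⟨⟨x, Submodule.mem_top⟩, hx⟩

theorem inverse_ofBounded_apply {B : 𝓗 →L[ℂ] 𝓗} (hB : Function.Injective B) (x : 𝓗) :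
    ∃ h : B x ∈ (ofBounded B).inverse.domain, (ofBounded B).inverse ⟨B x, h⟩ = x := by
  refine ⟨(inverse_ofBounded_domain B _).2 ⟨x, rfl⟩, ?_⟩
  refine LinearPMap.inverse_apply_eq (x := ⟨x, Submodule.mem_top⟩) ?_ rfl
  rw [LinearMap.ker_eq_bot']
  intro z hz
  exact Subtype.ext (hB (hz.trans (map_zero B).symm))

theorem IsBoundedInverse.eq {T : 𝓗 →ₗ.[ℂ] 𝓗} {B B' : 𝓗 →L[ℂ] 𝓗} (h : IsBoundedInverse T B)
    (h' : IsBoundedInverse T B') : B = B' := by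
  ext x
  obtain ⟨hx, hx'⟩ := h.1 x
  have h2 := h'.2 ⟨B x, hx⟩
  rw [hx'] at h2
  exact h2.symm

theorem IsBoundedInverse.boundedInverse_eq {T : 𝓗 →ₗ.[ℂ] 𝓗} {B : 𝓗 →L[ℂ] 𝓗}
    (h : IsBoundedInverse T B) : boundedInverse T = B := by
  have hex : ∃ B, IsBoundedInverse T B := ⟨B, h⟩
  rw [boundedInverse, dif_pos hex]
  exact hex.choose_spec.eq h

theorem injective_of_mul_self_injective {B : 𝓗 →L[ℂ] 𝓗} (h : Function.Injective (B * B)) :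
    Function.Injective B := by
  intro x y hxy
  apply h
  rw [mul_apply_eq_comp, mul_apply_eq_comp, hxy]

variable [CompleteSpace 𝓗]

/-! ### Bounded inverses of self-adjoint operators -/

theorem inner_apply_left_eq_of_isSelfAdjoint {T : 𝓗 →ₗ.[ℂ] 𝓗} (hT : IsSelfAdjoint T)
    (x y : T.domain) : ⟪T x, (y : 𝓗)⟫_ℂ = ⟪(x : 𝓗), T y⟫_ℂ := by
  have h := LinearPMap.adjoint_isFormalAdjoint hT.dense_domain
  rw [LinearPMap.isSelfAdjoint_def.1 hT] at h
  exact h x y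

/-- A self-adjoint operator bounded below by `c > 0` is bijective: its range is closed because of
the lower bound, and dense because its orthogonal complement is the kernel of `T† = T`. -/
theorem exists_isBoundedInverse {T : 𝓗 →ₗ.[ℂ] 𝓗} (hT : IsSelfAdjoint T) {c : ℝ} (hc : 0 < c)
    (hT_ge : ∀ ψ : T.domain, c * ‖(ψ : 𝓗)‖ ^ 2 ≤ (inner ℂ (ψ : 𝓗) (T ψ)).re) :
    ∃ B : 𝓗 →L[ℂ] 𝓗, IsBoundedInverse T B := by
  have hlow : ∀ ψ : T.domain, c * ‖(ψ : 𝓗)‖ ≤ ‖T ψ‖ := by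
    intro ψ
    rcases eq_or_lt_of_le (norm_nonneg (ψ : 𝓗)) with h | h
    · rw [← h]; simp
    · have h1 := (hT_ge ψ).trans ((Complex.re_le_norm _).trans (norm_inner_le_norm _ _))
      nlinarith
  have hinj : ∀ x y : T.domain, T x = T y → x = y := by
    intro x y hxy
    have h := hlow (x - y)
    rw [T.map_sub, hxy, sub_self, norm_zero] at h
    have h2 : ‖((x - y : T.domain) : 𝓗)‖ = 0 := by
      have := norm_nonneg ((x - y : T.domain) : 𝓗)
      nlinarith
    exact sub_eq_zero.1 (Subtype.ext (norm_eq_zero.1 h2))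
  have hclosed : IsClosed (LinearMap.range T.toFun : Set 𝓗) := by
    refine isClosed_of_closure_subset fun y hy => ?_
    obtain ⟨u, hu, hlim⟩ := mem_closure_iff_seq_limit.1 hy
    choose x hx using hu
    have hx' : ∀ n, T (x n) = u n := hx
    have hcau : CauchySeq fun n => (x n : 𝓗) := by
      have hu := hlim.cauchySeq
      rw [Metric.cauchySeq_iff] at hu ⊢
      intro e he
      obtain ⟨N, hN⟩ := hu (c * e) (by positivity)
      refine ⟨N, fun m hm n hn => ?_⟩
      have h1 := hN m hm n hn
      rw [dist_eq_norm, ← hx', ← hx', ← T.map_sub] at h1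
      have h2 := (hlow (x m - x n)).trans_lt h1
      rw [dist_eq_norm]
      exact lt_of_mul_lt_mul_left h2 hc.le
    obtain ⟨z, hz⟩ := cauchySeq_tendsto_of_complete hcau
    have hmem : (z, y) ∈ (T.graph : Set (𝓗 × 𝓗)) := by
      refine hT.isClosed.mem_of_tendsto (hz.prodMk_nhds hlim) (Filter.Eventually.of_forall ?_)
      intro n
      rw [← hx' n]
      exact T.mem_graph (x n)
    obtain ⟨w, -, hw⟩ := (LinearPMap.mem_graph_iff T).1 hmem
    exact ⟨w, hw⟩
  have hperp : (LinearMap.range T.toFun)ᗮ = ⊥ := by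
    rw [Submodule.eq_bot_iff]
    intro y hy
    have h0 : ∀ x : T.domain, ⟪y, T x⟫_ℂ = 0 := fun x =>
      (Submodule.mem_orthogonal' _ _).1 hy _ ⟨x, rfl⟩
    have hy' : y ∈ T.adjoint.domain :=
      LinearPMap.mem_adjoint_domain_of_exists y ⟨0, fun x => by rw [h0 x, inner_zero_left]⟩
    rw [LinearPMap.isSelfAdjoint_def.1 hT] at hy'
    have h1 := hT_ge ⟨y, hy'⟩
    rw [h0 ⟨y, hy'⟩] at h1
    have h2 : ‖y‖ ^ 2 ≤ 0 := by
      simp only [Complex.zero_re] at h1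
      nlinarith
    exact norm_eq_zero.1 (by nlinarith [norm_nonneg y])
  have hsurj : ∀ y : 𝓗, ∃ x : T.domain, T x = y := by
    have htop : LinearMap.range T.toFun = ⊤ := by
      rw [← Submodule.topologicalClosure_eq_top_iff] at hperp
      rw [← hperp]
      exact hclosed.submodule_topologicalClosure_eq.symm
    intro y
    exact LinearMap.range_eq_top.1 htop y
  choose f hf using hsurj
  have hf' : ∀ x : T.domain, f (T x) = x := fun x => hinj _ _ (hf _)
  let L : 𝓗 →ₗ[ℂ] 𝓗 :=
    { toFun := fun y => f y
      map_add' := fun y z => by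
        rw [← Submodule.coe_add]
        congr 1
        exact hinj _ _ (by rw [hf, T.map_add, hf, hf])
      map_smul' := fun k y => by
        rw [RingHom.id_apply, ← Submodule.coe_smul]
        congr 1
        exact hinj _ _ (by rw [hf, T.map_smul, hf]) }
  refine ⟨L.mkContinuous c⁻¹ fun y => ?_, fun y => ⟨(f y).2, hf y⟩, fun x => ?_⟩
  · have := hlow (f y)
    rw [hf] at this
    rw [inv_mul_eq_div, le_div_iff₀' hc]
    exact this
  · change ((f (T x) : T.domain) : 𝓗) = x
    rw [hf']

/-! ### Half-integer powers -/

theorem halfPow_neg_apply {T : 𝓗 →ₗ.[ℂ] 𝓗} {B : 𝓗 →L[ℂ] 𝓗}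
    (hTB : CFC.sqrt (boundedInverse T) = B) (m : ℕ) (x : 𝓗) :
    ∃ h : x ∈ (halfPow T (-(m : ℤ))).domain, halfPow T (-(m : ℤ)) ⟨x, h⟩ = (B ^ m) x := by
  subst hTB
  cases m with
  | zero => exact inverse_ofBounded_apply (B := negHalfPow T 0) (fun _ _ h => h) x
  | succ m => exact ofBounded_apply (negHalfPow T (m + 1)) x

theorem halfPow_natCast_apply {T : 𝓗 →ₗ.[ℂ] 𝓗} {B : 𝓗 →L[ℂ] 𝓗}
    (hTB : CFC.sqrt (boundedInverse T) = B) (hB : Function.Injective B) (m : ℕ) (x : 𝓗) :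
    ∃ h : (B ^ m) x ∈ (halfPow T (m : ℤ)).domain, halfPow T (m : ℤ) ⟨(B ^ m) x, h⟩ = x := by
  subst hTB
  refine inverse_ofBounded_apply (B := CFC.sqrt (boundedInverse T) ^ m) ?_ x
  rw [FunLike.coe_pow_eq_iterate]
  exact hB.iterate m

theorem mem_halfPow_natCast_domain {T : 𝓗 →ₗ.[ℂ] 𝓗} {B : 𝓗 →L[ℂ] 𝓗}
    (hTB : CFC.sqrt (boundedInverse T) = B) (m : ℕ) (y : 𝓗) :
    y ∈ (halfPow T (m : ℤ)).domain ↔ ∃ x, (B ^ m) x = y := by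
  subst hTB
  exact inverse_ofBounded_domain _ y

/-- For `j ≥ 1`, the operator `T^{(j-2)/2}` maps `T^{-j/2} x` to `T^{-1} x`. -/
theorem halfPow_sub_two_apply {T : 𝓗 →ₗ.[ℂ] 𝓗} {B : 𝓗 →L[ℂ] 𝓗}
    (hTB : CFC.sqrt (boundedInverse T) = B) (hB : Function.Injective B) {j : ℕ} (hj : 1 ≤ j)
    (x : 𝓗) :
    ∃ h : (B ^ j) x ∈ (halfPow T ((j : ℤ) - 2)).domain,
      halfPow T ((j : ℤ) - 2) ⟨(B ^ j) x, h⟩ = (B ^ 2) x := by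
  rcases Nat.lt_or_ge j 2 with h | h
  · obtain rfl : j = 1 := by omega
    obtain ⟨h1, h2⟩ := halfPow_neg_apply hTB 1 ((B ^ 1) x)
    refine ⟨h1, h2.trans ?_⟩
    rw [← mul_apply_eq_comp, ← pow_add]
  · obtain ⟨i, rfl⟩ := Nat.exists_eq_add_of_le' h
    have e : ((i + 2 : ℕ) : ℤ) - 2 = (i : ℤ) := by push_cast; ring
    rw [e, pow_add, mul_apply_eq_comp]
    exact halfPow_natCast_apply hTB hB i _

/-! ### Square roots of positive operators -/

theorem inner_apply_left_of_isSelfAdjoint {B : 𝓗 →L[ℂ] 𝓗} (hB : IsSelfAdjoint B) (x y : 𝓗) :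
    ⟪B x, y⟫_ℂ = ⟪x, B y⟫_ℂ := by
  rw [← ContinuousLinearMap.adjoint_inner_right, ContinuousLinearMap.isSelfAdjoint_iff'.1 hB]

theorem norm_sq_apply_of_isSelfAdjoint {B : 𝓗 →L[ℂ] 𝓗} (hB : IsSelfAdjoint B) (x : 𝓗) :
    ((‖B x‖ ^ 2 : ℝ) : ℂ) = ⟪x, (B * B) x⟫_ℂ := by
  rw [mul_apply_eq_comp, ← inner_apply_left_of_isSelfAdjoint hB,
    inner_self_eq_norm_sq_to_K]
  push_cast
  rfl

theorem denseRange_of_isSelfAdjoint_of_injective {B : 𝓗 →L[ℂ] 𝓗} (hB : IsSelfAdjoint B)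
    (hinj : Function.Injective B) : Dense {y | ∃ x, B x = y} := by
  have h : (LinearMap.range (B : 𝓗 →ₗ[ℂ] 𝓗)).topologicalClosure = ⊤ := by
    rw [Submodule.topologicalClosure_eq_top_iff, Submodule.eq_bot_iff]
    intro y hy
    apply hinj
    rw [map_zero]
    refine ext_inner_left ℂ fun x => ?_
    rw [inner_zero_right, ← inner_apply_left_of_isSelfAdjoint hB]
    exact (Submodule.mem_orthogonal _ _).1 hy _ ⟨x, rfl⟩
  have h2 := Submodule.dense_iff_topologicalClosure_eq_top.2 h
  exact h2

end

section

variable {𝓗 : Type*} [NormedAddCommGroup 𝓗] [InnerProductSpace ℂ 𝓗]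

theorem norm_pow_apply_le {B : 𝓗 →L[ℂ] 𝓗} (h : ∀ x, ‖B x‖ ≤ ‖x‖) (i : ℕ) (x : 𝓗) :
    ‖(B ^ i) x‖ ≤ ‖x‖ := by
  induction i with
  | zero => exact le_rfl
  | succ i ih => rw [pow_succ', mul_apply_eq_comp]; exact (h _).trans ih

variable [CompleteSpace 𝓗]

/-! ### The quadratic form of the derivative of a power of the resolvent -/

/-- The constant `A + E₁ + ⋯ + E_k` in the bound on the form of `R G R ^ k`. -/
def formConst (A : ℝ) (e : ℕ → ℝ) (k : ℕ) : ℝ := A + ∑ i ∈ Finset.Icc 1 k, e i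

/-- The assumptions, in terms of bounded operators only, on `B = H^{-1/2}` and `G = H₁ H⁻¹`: the
operator `H⁻¹ H₁ H⁻¹` is symmetric, `H₁` is bounded by `A H^{1/2}`, and the image `w = K H⁻¹ v`
under the commutator `K = [H₁, H]` is controlled in terms of `v` in the norms `‖B ^ k ·‖` for
`1 ≤ k ≤ m`. -/
structure FormBounds (B G : 𝓗 →L[ℂ] 𝓗) (A : ℝ) (e : ℕ → ℝ) (m : ℕ) : Prop where
  selfAdjoint : IsSelfAdjoint B
  norm_le : ∀ x, ‖B x‖ ≤ ‖x‖
  symm : ∀ x y, ⟪(B ^ 2) x, G y⟫_ℂ = ⟪G x, (B ^ 2) y⟫_ℂ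
  A_nonneg : 0 ≤ A
  e_nonneg : ∀ k, 1 ≤ k → k ≤ m → 0 ≤ e k
  bound : ∀ x, ‖G x‖ ≤ A * ‖B x‖
  comm : 1 ≤ m → ∀ v, ∃ w, (∀ p, ⟪(B ^ 2) p, w⟫_ℂ = ⟪G p, v⟫_ℂ - ⟪p, G v⟫_ℂ) ∧
    ∀ k, 1 ≤ k → k ≤ m → ‖(B ^ k) w‖ ≤ e k * ‖(B ^ k) v‖

theorem inner_pow_left_of_isSelfAdjoint {B : 𝓗 →L[ℂ] 𝓗} (hB : IsSelfAdjoint B) (k : ℕ)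
    (x y : 𝓗) : ⟪(B ^ k) x, y⟫_ℂ = ⟪x, (B ^ k) y⟫_ℂ :=
  inner_apply_left_of_isSelfAdjoint (hB.pow k) x y

theorem formConst_mono {A : ℝ} {e : ℕ → ℝ} {m i j : ℕ} (he : ∀ k, 1 ≤ k → k ≤ m → 0 ≤ e k)
    (hij : i ≤ j) (hj : j ≤ m) : formConst A e i ≤ formConst A e j := by
  refine add_le_add_right ?_ A
  refine Finset.sum_le_sum_of_subset_of_nonneg (Finset.Icc_subset_Icc_right hij) fun k hk _ => ?_
  rw [Finset.mem_Icc] at hk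
  exact he k hk.1 (hk.2.trans hj)

theorem formConst_succ (A : ℝ) (e : ℕ → ℝ) (k : ℕ) :
    formConst A e (k + 1) = formConst A e k + e (k + 1) := by
  rw [formConst, formConst, Finset.sum_Icc_succ_top (by omega), add_assoc]

namespace FormBounds

variable {B G : 𝓗 →L[ℂ] 𝓗} {A : ℝ} {e : ℕ → ℝ} {m : ℕ}

theorem formConst_nonneg (h : FormBounds B G A e m) {k : ℕ} (hk : k ≤ m) :
    0 ≤ formConst A e k := by
  refine h.A_nonneg.trans
    (le_trans (le_of_eq ?_) (formConst_mono (A := A) h.e_nonneg (Nat.zero_le k) hk))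
  simp [formConst]

theorem norm_pow_antitone (h : FormBounds B G A e m) {i j : ℕ} (hij : i ≤ j) (x : 𝓗) :
    ‖(B ^ j) x‖ ≤ ‖(B ^ i) x‖ := by
  obtain ⟨d, rfl⟩ := Nat.exists_eq_add_of_le' hij
  rw [pow_add, mul_apply_eq_comp]
  exact norm_pow_apply_le h.norm_le d _

/-- The form of `R G R ^ k = H⁻¹ H₁ H^{-(k+1)}` is bounded by the form of `H^{-(k+1)}`. Commuting
`H₁` through one resolvent, `[H₁, R] = -R K R`, reduces `k + 2` to `k`. -/
theorem norm_inner_le (h : FormBounds B G A e m) (k : ℕ) (hk : k + 1 ≤ m) (u : 𝓗) :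
    ‖⟪(B ^ 2) u, G ((B ^ (2 * k)) u)⟫_ℂ‖ ≤ formConst A e k * ‖(B ^ (k + 1)) u‖ ^ 2 := by
  induction k using Nat.twoStepInduction generalizing u with
  | zero =>
    have h1 := norm_inner_le_norm (𝕜 := ℂ) ((B ^ 2) u) (G u)
    have h2 := h.norm_pow_antitone one_le_two u
    have h3 := h.bound u
    have h4 : formConst A e 0 = A := by simp [formConst]
    rw [pow_one] at h2
    rw [h4, mul_zero, pow_zero, zero_add, pow_one, one_apply_eq_self]
    have h5 := h.A_nonneg
    calc _ ≤ _ := h1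
      _ ≤ ‖B u‖ * (A * ‖B u‖) := by gcongr
      _ = _ := by ring
  | one =>
    have h1 := norm_inner_le_norm (𝕜 := ℂ) ((B ^ 2) u) (G ((B ^ 2) u))
    have h3 := (h.bound ((B ^ 2) u)).trans
      (mul_le_mul_of_nonneg_left (h.norm_le ((B ^ 2) u)) h.A_nonneg)
    have h4 : A ≤ formConst A e 1 := by
      have := h.e_nonneg 1 le_rfl (by omega)
      simpa [formConst] using this
    calc _ ≤ _ := h1
      _ ≤ ‖(B ^ 2) u‖ * (A * ‖(B ^ 2) u‖) := by gcongr
      _ = A * ‖(B ^ (1 + 1)) u‖ ^ 2 := by ring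
      _ ≤ _ := by gcongr
  | more k ih _ =>
    have hpow : ∀ i j x, (B ^ i) ((B ^ j) x) = (B ^ (i + j)) x := fun i j x => by
      rw [← mul_apply_eq_comp, ← pow_add]
    obtain ⟨v, hv⟩ : ∃ v, v = (B ^ 2) u := ⟨_, rfl⟩
    have e1 : (B ^ (2 * (k + 2))) u = (B ^ (2 * k + 2)) v := by
      rw [hv, hpow]
      rfl
    obtain ⟨w, hw, hw'⟩ := h.comm (by omega) v
    have h1 := hw ((B ^ (2 * k + 2)) v)
    have h2 : ⟪(B ^ (2 * k + 2)) v, G v⟫_ℂ = ⟪G ((B ^ (2 * k)) v), (B ^ 2) v⟫_ℂ := by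
      rw [← h.symm, hpow (2), add_comm 2 (2 * k)]
    have h3 : ⟪(B ^ 2) ((B ^ (2 * k + 2)) v), w⟫_ℂ =
        ⟪(B ^ (k + 3)) v, (B ^ (k + 1)) w⟫_ℂ := by
      rw [hpow, ← inner_pow_left_of_isSelfAdjoint h.selfAdjoint, hpow,
        show 2 + (2 * k + 2) = k + 1 + (k + 3) by omega]
    rw [h2, h3] at h1
    rw [e1, ← hv, norm_inner_symm, eq_add_of_sub_eq h1.symm]
    have h4 := ih (by omega) v
    rw [norm_inner_symm] at h4
    have h5 := hw' (k + 1) (by omega) (by omega)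
    have h6 := norm_inner_le_norm (𝕜 := ℂ) ((B ^ (k + 3)) v) ((B ^ (k + 1)) w)
    have h7 := h.norm_pow_antitone (show k + 1 ≤ k + 3 by omega) v
    have h8 : (B ^ (k + 2 + 1)) u = (B ^ (k + 1)) v := by rw [hv, hpow]
    have h9 := formConst_mono (A := A) h.e_nonneg (Nat.le_succ (k + 1)) (show k + 2 ≤ m by omega)
    rw [Nat.succ_eq_add_one, formConst_succ A e k] at h9
    rw [h8]
    calc _ ≤ _ := norm_add_le _ _
      _ ≤ ‖(B ^ (k + 1)) v‖ * (e (k + 1) * ‖(B ^ (k + 1)) v‖) +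
          formConst A e k * ‖(B ^ (k + 1)) v‖ ^ 2 := by
        refine add_le_add (h6.trans ?_) h4
        gcongr
      _ = (formConst A e k + e (k + 1)) * ‖(B ^ (k + 1)) v‖ ^ 2 := by ring
      _ ≤ _ := by gcongr

/-- If `R(t) = H(t)⁻¹` has derivative `d R G`, the derivative `D` of `R ^ k` at `t` is bounded,
as a quadratic form, by `R ^ k` itself. Writing `R ^ (k + 2) = R R ^ k R` reduces `k + 2` to
`k`. -/
theorem exists_hasDerivAt_pow {R : ℝ → 𝓗 →L[ℂ] 𝓗} {t : ℝ} (hR : R t = B ^ 2) {d : ℝ}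
    (hR' : HasDerivAt R ((d : ℂ) • (B ^ 2 * G)) t) (h : FormBounds B G A e m) (k : ℕ)
    (hk : k ≤ m) :
    ∃ D : 𝓗 →L[ℂ] 𝓗, HasDerivAt (fun s => R s ^ k) D t ∧ ∀ u,
      ‖⟪u, D u⟫_ℂ‖ ≤ 2 * |d| * (∑ j ∈ Finset.range k, formConst A e j) * ‖(B ^ k) u‖ ^ 2 := by
  have hR2 : ∀ x y, ⟪(B ^ 2) x, y⟫_ℂ = ⟪x, (B ^ 2) y⟫_ℂ :=
    inner_pow_left_of_isSelfAdjoint h.selfAdjoint 2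
  induction k using Nat.twoStepInduction with
  | zero =>
    refine ⟨0, ?_, fun u => ?_⟩
    · simpa using hasDerivAt_const t (1 : 𝓗 →L[ℂ] 𝓗)
    · simp
  | one =>
    refine ⟨_, by simpa only [pow_one] using hR', fun u => ?_⟩
    have h1 := h.norm_inner_le 0 hk u
    have h2 : ⟪u, ((d : ℂ) • (B ^ 2 * G)) u⟫_ℂ = d * ⟪(B ^ 2) u, G ((B ^ (2 * 0)) u)⟫_ℂ := by
      rw [hR2, FunLike.coe_smul, Pi.smul_apply, inner_smul_right]
      rfl
    have h0 := h.formConst_nonneg (Nat.zero_le m)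
    rw [h2, norm_mul, Complex.norm_real, Real.norm_eq_abs, Finset.sum_range_one]
    calc _ ≤ |d| * (formConst A e 0 * ‖(B ^ (0 + 1)) u‖ ^ 2) := by gcongr
      _ ≤ 2 * (|d| * (formConst A e 0 * ‖(B ^ (0 + 1)) u‖ ^ 2)) :=
        le_mul_of_one_le_left (by positivity) one_le_two
      _ = _ := by ring
  | more k ih _ =>
    obtain ⟨D, hD, hD'⟩ := ih (by omega)
    have hder := (hR'.mul hD).mul hR'
    refine ⟨((d : ℂ) • (B ^ 2 * G) * R t ^ k + R t * D) * R t +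
      R t * R t ^ k * ((d : ℂ) • (B ^ 2 * G)),
      hder.congr_of_eventuallyEq (Filter.Eventually.of_forall fun s => ?_), fun u => ?_⟩
    · change R s ^ (k + 2) = R s * R s ^ k * R s
      rw [← pow_succ', ← pow_succ]
    have e1 : ⟪u, (((d : ℂ) • (B ^ 2 * G) * R t ^ k + R t * D) * R t +
        R t * R t ^ k * ((d : ℂ) • (B ^ 2 * G))) u⟫_ℂ =
        d * ⟪(B ^ 2) u, G ((B ^ (2 * (k + 1))) u)⟫_ℂ + ⟪(B ^ 2) u, D ((B ^ 2) u)⟫_ℂ +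
          d * ⟪G ((B ^ (2 * (k + 1))) u), (B ^ 2) u⟫_ℂ := by
      have h3 : ⟪u, (B ^ 2 * (B ^ 2) ^ k * (B ^ 2 * G)) u⟫_ℂ =
          ⟪G ((B ^ (2 * (k + 1))) u), (B ^ 2) u⟫_ℂ := by
        rw [← h.symm, hR2, inner_pow_left_of_isSelfAdjoint h.selfAdjoint, ← mul_apply_eq_comp,
          ← mul_apply_eq_comp, ← pow_mul, ← mul_assoc, ← pow_add, ← pow_add, ← pow_add,
          show 2 + 2 * k + 2 = 2 * (k + 1) + 2 by omega]
      have h4 : (B ^ 2 * G * (B ^ 2) ^ k * B ^ 2) u =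
          (B ^ 2) (G ((B ^ (2 * (k + 1))) u)) := by
        rw [mul_assoc, ← pow_succ, ← pow_mul]
        rfl
      rw [← h3, hR2 u, ← h4, hR2 u, ← inner_smul_right, ← inner_smul_right, ← inner_add_right,
        ← inner_add_right, hR]
      congr 1
      simp only [add_mul, smul_mul_assoc, mul_smul_comm, FunLike.coe_add, Pi.add_apply,
        FunLike.coe_smul, Pi.smul_apply]
      rfl
    have h1 := h.norm_inner_le (k + 1) hk u
    have h2 := hD' ((B ^ 2) u)
    rw [← mul_apply_eq_comp (f := B ^ k), ← pow_add] at h2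
    rw [e1, Finset.sum_range_succ, Finset.sum_range_succ]
    have h0 := h.formConst_nonneg (show k ≤ m by omega)
    calc
      _ ≤ |d| * (formConst A e (k + 1) * ‖(B ^ (k + 2)) u‖ ^ 2) +
          2 * |d| * (∑ j ∈ Finset.range k, formConst A e j) * ‖(B ^ (k + 2)) u‖ ^ 2 +
          |d| * (formConst A e (k + 1) * ‖(B ^ (k + 2)) u‖ ^ 2) := by
        refine (norm_add_le _ _).trans (add_le_add ((norm_add_le _ _).trans (add_le_add ?_ h2)) ?_)
        · rw [norm_mul, Complex.norm_real, Real.norm_eq_abs]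
          gcongr
        · rw [norm_mul, Complex.norm_real, Real.norm_eq_abs, norm_inner_symm]
          gcongr
      _ = 2 * |d| * (∑ j ∈ Finset.range k, formConst A e j + 0 + formConst A e (k + 1)) *
          ‖(B ^ (k + 2)) u‖ ^ 2 := by ring
      _ ≤ _ := by gcongr

end FormBounds

end

section

/-! ### The switching function -/

theorem deriv_eq_zero_of_notMem_Ioo {g : ℝ → ℝ} (hg' : tsupport (deriv g) ⊆ Set.Ioo 0 1) {s : ℝ}
    (hs : s ∉ Set.Ioo (0 : ℝ) 1) : deriv g s = 0 :=
  image_eq_zero_of_notMem_tsupport fun h => hs (hg' h)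

theorem abs_le_maxAbs_of_mem {f : ℝ → ℝ} (hf : Continuous f) {s : ℝ} (hs : s ∈ Set.Icc (0 : ℝ) 1) :
    |f s| ≤ maxAbs f :=
  le_csSup (isCompact_Icc.image hf.abs).bddAbove ⟨s, hs, rfl⟩

theorem maxAbs_nonneg (f : ℝ → ℝ) : 0 ≤ maxAbs f := by
  refine Real.sSup_nonneg ?_
  rintro _ ⟨s, -, rfl⟩
  exact abs_nonneg _

theorem abs_deriv_le_maxAbs {g : ℝ → ℝ} (hg : ContDiff ℝ 1 g)
    (hg' : tsupport (deriv g) ⊆ Set.Ioo 0 1) (s : ℝ) : |deriv g s| ≤ maxAbs (deriv g) := by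
  by_cases hs : s ∈ Set.Ioo (0 : ℝ) 1
  · exact abs_le_maxAbs_of_mem hg.continuous_deriv_one (Set.Ioo_subset_Icc_self hs)
  · rw [deriv_eq_zero_of_notMem_Ioo hg' hs, abs_zero]
    exact maxAbs_nonneg _

/-- A function whose derivative is bounded by `C` on `[0, L]` and vanishes elsewhere varies by at
most `C * L`, over any interval and in both time directions. -/
theorem abs_sub_le_of_abs_deriv_le {f f' : ℝ → ℝ} (hf : ∀ x, HasDerivAt f (f' x) x) {C L : ℝ}
    (hL : 0 ≤ L) (hbound : ∀ x, |f' x| ≤ C) (hleft : ∀ x ≤ 0, f' x = 0)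
    (hright : ∀ x, L ≤ x → f' x = 0) (x y : ℝ) : |f x - f y| ≤ C * L := by
  -- `p x` is the point of `[0, L]` nearest to `x`; `f` takes the same value there as at `x`.
  obtain ⟨p, hp, hpf⟩ : ∃ p : ℝ → ℝ, (∀ x, p x ∈ Set.Icc 0 L) ∧ ∀ x, f (p x) = f x := by
    refine ⟨fun x => max 0 (min x L), fun x => ⟨le_max_left _ _, max_le hL (min_le_right _ _)⟩,
      fun x => ?_⟩
    have hconst : ∀ s : Set ℝ, Convex ℝ s → (∀ z ∈ s, f' z = 0) → ∀ z ∈ s, ∀ w ∈ s,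
        f z = f w := by
      intro s hs h0 z hz w hw
      have := hs.norm_image_sub_le_of_norm_hasDerivWithin_le (C := 0)
        (fun z _ => (hf z).hasDerivWithinAt) (fun z hz => by rw [h0 z hz, norm_zero]) hw hz
      rw [zero_mul] at this
      exact sub_eq_zero.1 (norm_le_zero_iff.1 this)
    rcases le_total x 0 with h | h
    · refine hconst (Set.Iic 0) (convex_Iic 0) hleft _ ?_ _ h
      simp [h]
    · rcases le_total x L with h' | h'
      · simp [h, h']
      · refine hconst (Set.Ici L) (convex_Ici L) hright _ ?_ _ h'
        simp [h']
  have h := (convex_Icc 0 L).norm_image_sub_le_of_norm_hasDerivWithin_le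
    (fun z _ => (hf z).hasDerivWithinAt) (fun z _ => hbound z) (hp y) (hp x)
  rw [hpf, hpf, Real.norm_eq_abs] at h
  refine h.trans ?_
  have hC : 0 ≤ C := (abs_nonneg _).trans (hbound 0)
  gcongr
  rw [Real.norm_eq_abs, abs_le]
  constructor <;> linarith [(hp x).1, (hp x).2, (hp y).1, (hp y).2]

theorem abs_le_maxAbs {g : ℝ → ℝ} (hg : ContDiff ℝ 1 g) (hg' : tsupport (deriv g) ⊆ Set.Ioo 0 1)
    (hg0 : ∀ s < 0, g s = 0) (s : ℝ) : |g s| ≤ maxAbs g := by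
  rcases lt_or_ge s 0 with h0 | h0
  · rw [hg0 s h0, abs_zero]
    exact maxAbs_nonneg g
  rcases le_or_gt s 1 with h1 | h1
  · exact abs_le_maxAbs_of_mem hg.continuous ⟨h0, h1⟩
  · have hd : ∀ z, HasDerivAt g (deriv g z) z := fun z =>
      (hg.differentiable one_ne_zero z).hasDerivAt
    have h := (convex_Ici (1 : ℝ)).norm_image_sub_le_of_norm_hasDerivWithin_le (C := 0)
      (fun z _ => (hd z).hasDerivWithinAt)
      (fun z hz => by
        rw [deriv_eq_zero_of_notMem_Ioo hg' fun hz' => (not_lt.2 hz) hz'.2, norm_zero])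
      Set.self_mem_Ici (Set.mem_Ici.2 h1.le)
    rw [zero_mul] at h
    rw [sub_eq_zero.1 (norm_le_zero_iff.1 h)]
    exact abs_le_maxAbs_of_mem hg.continuous ⟨zero_le_one, le_rfl⟩

/-- A positive function `F` with `|F'(t)| ≤ κ |η g'(η t)| F(t)` changes by a factor of at most
`exp (κ max |g'|)`, uniformly in `η > 0`. -/
theorem le_exp_mul_of_abs_deriv_le {g : ℝ → ℝ} (hg : ContDiff ℝ 1 g)
    (hg' : tsupport (deriv g) ⊆ Set.Ioo 0 1) {η κ : ℝ} (hη : 0 < η) (hκ : 0 ≤ κ)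
    {F F' : ℝ → ℝ} (hpos : ∀ t, 0 < F t) (hF : ∀ t, HasDerivAt F (F' t) t)
    (hbound : ∀ t, |F' t| ≤ κ * |η * deriv g (η * t)| * F t) (t r : ℝ) :
    F t ≤ Real.exp (κ * maxAbs (deriv g)) * F r := by
  have hlog : ∀ x, HasDerivAt (fun s => Real.log (F s)) (F' x / F x) x := fun x =>
    (hF x).log (hpos x).ne'
  have hb : ∀ x, |F' x / F x| ≤ κ * |η * deriv g (η * x)| := fun x => by
    rw [abs_div, abs_of_pos (hpos x), div_le_iff₀ (hpos x)]
    exact hbound x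
  have hzero : ∀ x, η * x ∉ Set.Ioo (0 : ℝ) 1 → F' x / F x = 0 := fun x hx => by
    have := hb x
    rw [deriv_eq_zero_of_notMem_Ioo hg' hx, mul_zero, abs_zero, mul_zero] at this
    exact abs_nonpos_iff.1 this
  have h := abs_sub_le_of_abs_deriv_le hlog (C := κ * (η * maxAbs (deriv g))) (L := η⁻¹)
    (by positivity)
    (fun x => (hb x).trans (by
      rw [abs_mul, abs_of_pos hη]
      gcongr
      exact abs_deriv_le_maxAbs hg hg' _))
    (fun x hx => hzero x fun h => by nlinarith [h.1])
    (fun x hx => hzero x fun h => by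
      have := mul_le_mul_of_nonneg_left hx hη.le
      rw [mul_inv_cancel₀ hη.ne'] at this
      linarith [h.2]) t r
  have h2 := (le_abs_self _).trans h
  rw [show κ * (η * maxAbs (deriv g)) * η⁻¹ = κ * maxAbs (deriv g) by field_simp] at h2
  rw [← Real.exp_log (hpos t), ← Real.exp_log (hpos r), ← Real.exp_add]
  exact Real.exp_le_exp.2 (by linarith)

end

section

variable {𝓗 : Type*} [NormedAddCommGroup 𝓗] [InnerProductSpace ℂ 𝓗]

theorem add_smul_apply {H₀ H₁ : 𝓗 →ₗ.[ℂ] 𝓗} (c : ℂ) {x y z : 𝓗}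
    (hx : ∃ h : x ∈ H₀.domain, H₀ ⟨x, h⟩ = y) (hx' : ∃ h : x ∈ H₁.domain, H₁ ⟨x, h⟩ = z) :
    ∃ h : x ∈ (H₀ + c • H₁).domain, (H₀ + c • H₁) ⟨x, h⟩ = y + c • z := by
  obtain ⟨h, rfl⟩ := hx
  obtain ⟨h', rfl⟩ := hx'
  exact ⟨⟨h, h'⟩, rfl⟩

variable [CompleteSpace 𝓗]

/-! ### The operator `T^{-1/2}` -/

/-- `B` is the operator `T^{-1/2}` of a symmetric `T ≥ 1` with bounded inverse. -/
structure IsInvSqrt (T : 𝓗 →ₗ.[ℂ] 𝓗) (B : 𝓗 →L[ℂ] 𝓗) : Prop where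
  sqrt_eq : CFC.sqrt (boundedInverse T) = B
  selfAdjoint : IsSelfAdjoint B
  inverse : IsBoundedInverse T (B ^ 2)
  injective : Function.Injective B
  norm_le : ∀ x, ‖B x‖ ≤ ‖x‖

theorem IsBoundedInverse.exists_isInvSqrt {T : 𝓗 →ₗ.[ℂ] 𝓗} {R : 𝓗 →L[ℂ] 𝓗}
    (hR : IsBoundedInverse T R) (hsymm : ∀ x y : T.domain, ⟪T x, (y : 𝓗)⟫_ℂ = ⟪(x : 𝓗), T y⟫_ℂ)
    (hge : ∀ ψ : T.domain, ‖(ψ : 𝓗)‖ ^ 2 ≤ (inner ℂ (ψ : 𝓗) (T ψ)).re) :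
    ∃ B, IsInvSqrt T B ∧ B ^ 2 = R := by
  have hsa : IsSelfAdjoint R := by
    rw [ContinuousLinearMap.isSelfAdjoint_iff_isSymmetric]
    intro x y
    obtain ⟨hx, hx'⟩ := hR.1 x
    obtain ⟨hy, hy'⟩ := hR.1 y
    have h := hsymm ⟨R x, hx⟩ ⟨R y, hy⟩
    rw [hx', hy'] at h
    exact h.symm
  have hge' : ∀ x, ‖R x‖ ^ 2 ≤ (inner ℂ (R x) x).re := by
    intro x
    obtain ⟨hx, hx'⟩ := hR.1 x
    have h := hge ⟨R x, hx⟩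
    rwa [hx'] at h
  have hpos : 0 ≤ R := by
    rw [ContinuousLinearMap.nonneg_iff_isPositive, ContinuousLinearMap.isPositive_def]
    refine ⟨ContinuousLinearMap.isSelfAdjoint_iff_isSymmetric.1 hsa, fun x => ?_⟩
    exact (sq_nonneg _).trans (hge' x)
  have hB : IsSelfAdjoint (CFC.sqrt R) := IsSelfAdjoint.of_nonneg (CFC.sqrt_nonneg R)
  have hBB : CFC.sqrt R * CFC.sqrt R = R := CFC.sqrt_mul_sqrt_self R hpos
  have hnorm : ∀ x, ‖R x‖ ≤ ‖x‖ := by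
    intro x
    have h := (hge' x).trans ((Complex.re_le_norm _).trans (norm_inner_le_norm _ _))
    rcases eq_or_lt_of_le (norm_nonneg (R x)) with h0 | h0
    · rw [← h0]; exact norm_nonneg x
    · nlinarith
  have hinj : Function.Injective R := by
    intro x y hxy
    obtain ⟨hx, hx'⟩ := hR.1 x
    obtain ⟨hy, hy'⟩ := hR.1 y
    rw [← hx', ← hy']
    congr 1
    exact Subtype.ext hxy
  refine ⟨CFC.sqrt R, ⟨by rw [hR.boundedInverse_eq], hB, ?_, ?_, fun x => ?_⟩, ?_⟩
  · rwa [pow_two, hBB]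
  · exact injective_of_mul_self_injective (by rwa [hBB])
  · have h1 := norm_sq_apply_of_isSelfAdjoint hB x
    have h2 : ‖CFC.sqrt R x‖ ^ 2 ≤ ‖x‖ ^ 2 := by
      have h3 : ‖((‖CFC.sqrt R x‖ ^ 2 : ℝ) : ℂ)‖ ≤ ‖x‖ * ‖x‖ := by
        rw [h1, hBB]
        exact (norm_inner_le_norm _ _).trans (mul_le_mul_of_nonneg_left (hnorm x) (norm_nonneg x))
      rwa [Complex.norm_real, Real.norm_of_nonneg (sq_nonneg _), ← pow_two] at h3
    exact (sq_le_sq₀ (norm_nonneg _) (norm_nonneg _)).1 h2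
  · rw [pow_two, hBB]

/-! ### The perturbed operator -/

/-- Symmetric operators `H₀ ≥ 1 + γ₀` and `H₁`, together with the bounded operators
`B₀ = H₀^{-1/2}` and `W = H₁ H₀^{-1/2}`. -/
structure PerturbationData (H₀ H₁ : 𝓗 →ₗ.[ℂ] 𝓗) (γ₀ : ℝ) (B₀ W : 𝓗 →L[ℂ] 𝓗) : Prop where
  symm₀ : ∀ x y : H₀.domain, ⟪H₀ x, (y : 𝓗)⟫_ℂ = ⟪(x : 𝓗), H₀ y⟫_ℂ
  symm₁ : ∀ x y : H₁.domain, ⟪H₁ x, (y : 𝓗)⟫_ℂ = ⟪(x : 𝓗), H₁ y⟫_ℂ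
  ge : ∀ ψ : H₀.domain, (1 + γ₀) * ‖(ψ : 𝓗)‖ ^ 2 ≤ (inner ℂ (ψ : 𝓗) (H₀ ψ)).re
  invSqrt : IsInvSqrt H₀ B₀
  apply_eq : ∀ x, ∃ h : B₀ x ∈ H₁.domain, H₁ ⟨B₀ x, h⟩ = W x

theorem RelBounded.exists_perturbationData {H₀ H₁ : 𝓗 →ₗ.[ℂ] 𝓗} {γ₀ a b : ℝ} (hγ₀ : 0 < γ₀)
    (hH₀ : IsSelfAdjoint H₀)
    (hH₀_ge : ∀ ψ : H₀.domain, (1 + γ₀) * ‖(ψ : 𝓗)‖ ^ 2 ≤ (inner ℂ (ψ : 𝓗) (H₀ ψ)).re)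
    (hH₁ : IsSelfAdjoint H₁) (ha : 0 ≤ a) (hb : 0 ≤ b) (hrel : RelBounded H₁ (halfPow H₀ 1) a b) :
    ∃ B₀ W, PerturbationData H₀ H₁ γ₀ B₀ W ∧ (∀ x, ‖W x‖ ≤ a * ‖x‖ + b * ‖B₀ x‖) ∧
      (∀ x, ‖W x‖ ≤ pnorm (pcomp H₁ (halfPow H₀ (-1))) * ‖x‖) ∧
      ∀ x, ‖W (B₀ x)‖ ≤ pnorm (pcomp H₁ (halfPow H₀ (-2))) * ‖x‖ := by
  obtain ⟨R, hR⟩ := exists_isBoundedInverse hH₀ (by linarith) hH₀_ge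
  have hs := inner_apply_left_eq_of_isSelfAdjoint hH₀
  obtain ⟨B, hB, -⟩ := hR.exists_isInvSqrt hs fun ψ => by
    have := hH₀_ge ψ
    nlinarith [sq_nonneg ‖(ψ : 𝓗)‖]
  obtain ⟨hdom, hbd⟩ := hrel
  have hmem : ∀ x, ∃ h : B x ∈ H₁.domain, ‖H₁ ⟨B x, h⟩‖ ≤ a * ‖x‖ + b * ‖B x‖ := by
    intro x
    obtain ⟨h1, h2⟩ := halfPow_natCast_apply hB.sqrt_eq hB.injective 1 x
    rw [pow_one] at h1
    refine ⟨hdom h1, ?_⟩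
    have h3 := hbd ⟨B x, h1⟩
    have h4 : halfPow H₀ 1 ⟨B x, h1⟩ = x := by
      simp only [pow_one] at h2
      exact h2
    rwa [h4] at h3
  have hnn : 0 ≤ a + b := add_nonneg ha hb
  let L : 𝓗 →ₗ[ℂ] 𝓗 :=
    { toFun := fun x => H₁ ⟨B x, (hmem x).1⟩
      map_add' := fun x y => by
        rw [← H₁.map_add]
        congr 1
        exact Subtype.ext (map_add B x y)
      map_smul' := fun k x => by
        rw [RingHom.id_apply, ← H₁.map_smul]
        congr 1
        exact Subtype.ext (map_smul B k x) }
  have hL : ∀ x, ‖L x‖ ≤ (a + b) * ‖x‖ := fun x => by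
    have h1 := (hmem x).2
    have h2 := hB.norm_le x
    calc _ ≤ _ := h1
      _ ≤ a * ‖x‖ + b * ‖x‖ := by gcongr
      _ = _ := by ring
  have hpc : ∀ (j : ℕ) (x : 𝓗), ∃ h : x ∈ (pcomp H₁ (halfPow H₀ (-((j + 1 : ℕ) : ℤ)))).domain,
      pcomp H₁ (halfPow H₀ (-((j + 1 : ℕ) : ℤ))) ⟨x, h⟩ = L ((B ^ j) x) := fun j x =>
    mem_pcomp_domain (halfPow_neg_apply hB.sqrt_eq (j + 1) x) (by
      rw [pow_succ', mul_apply_eq_comp]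
      exact ⟨(hmem _).1, rfl⟩)
  have hpn : ∀ (j : ℕ) (x : 𝓗), ‖L ((B ^ j) x)‖ ≤
      pnorm (pcomp H₁ (halfPow H₀ (-((j + 1 : ℕ) : ℤ)))) * ‖x‖ := by
    intro j x
    obtain ⟨h1, h2⟩ := hpc j x
    rw [← h2]
    refine norm_apply_le_pnorm hnn (fun ψ => ?_) ⟨x, h1⟩
    obtain ⟨h3, h4⟩ := hpc j ψ
    rw [h4]
    refine (hL _).trans (mul_le_mul_of_nonneg_left ?_ hnn)
    exact norm_pow_apply_le hB.norm_le j _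
  refine ⟨B, L.mkContinuous (a + b) hL,
    ⟨hs, inner_apply_left_eq_of_isSelfAdjoint hH₁, hH₀_ge, hB, fun x => ⟨(hmem x).1, rfl⟩⟩,
    fun x => (hmem x).2, fun x => hpn 0 x, fun x => ?_⟩
  have := hpn 1 x
  rw [pow_one] at this
  exact this

namespace PerturbationData

variable {H₀ H₁ : 𝓗 →ₗ.[ℂ] 𝓗} {γ₀ : ℝ} {B₀ W : 𝓗 →L[ℂ] 𝓗}

theorem inner_apply (h : PerturbationData H₀ H₁ γ₀ B₀ W) (x y : 𝓗) :
    ⟪W x, B₀ y⟫_ℂ = ⟪B₀ x, W y⟫_ℂ := by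
  obtain ⟨hx, hx'⟩ := h.apply_eq x
  obtain ⟨hy, hy'⟩ := h.apply_eq y
  have := h.symm₁ ⟨B₀ x, hx⟩ ⟨B₀ y, hy⟩
  rwa [hx', hy'] at this

/-- `H₀ + c H₁` on vectors `H₀⁻¹ z`, in terms of bounded operators. -/
theorem add_smul_apply_sq (h : PerturbationData H₀ H₁ γ₀ B₀ W) (c : ℂ) (z : 𝓗) :
    ∃ hz : (B₀ ^ 2) z ∈ (H₀ + c • H₁).domain,
      (H₀ + c • H₁) ⟨(B₀ ^ 2) z, hz⟩ = (1 + c • (W * B₀)) z :=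
  add_smul_apply c (h.invSqrt.inverse.1 z) (h.apply_eq (B₀ z))

theorem exists_eq_sq (h : PerturbationData H₀ H₁ γ₀ B₀ W) {x : 𝓗} (hx : x ∈ H₀.domain) :
    ∃ z, (B₀ ^ 2) z = x :=
  ⟨H₀ ⟨x, hx⟩, h.invSqrt.inverse.2 ⟨x, hx⟩⟩

theorem isBoundedInverse (h : PerturbationData H₀ H₁ γ₀ B₀ W) {c : ℂ}
    (hu : IsUnit (1 + c • (W * B₀))) :
    IsBoundedInverse (H₀ + c • H₁) (B₀ ^ 2 * Ring.inverse (1 + c • (W * B₀))) := by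
  constructor
  · intro φ
    obtain ⟨h1, h2⟩ := h.add_smul_apply_sq c (Ring.inverse (1 + c • (W * B₀)) φ)
    refine ⟨h1, h2.trans ?_⟩
    rw [← mul_apply_eq_comp, Ring.mul_inverse_cancel _ hu, one_apply_eq_self]
  · rintro ⟨x, hx⟩
    obtain ⟨z, rfl⟩ := h.exists_eq_sq hx.1
    obtain ⟨h1, h2⟩ := h.add_smul_apply_sq c z
    rw [h2, ← mul_apply_eq_comp, mul_assoc, Ring.inverse_mul_cancel _ hu, mul_one]

theorem symm (h : PerturbationData H₀ H₁ γ₀ B₀ W) (c : ℝ) (x y : (H₀ + (c : ℂ) • H₁).domain) :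
    ⟪(H₀ + (c : ℂ) • H₁) x, (y : 𝓗)⟫_ℂ = ⟪(x : 𝓗), (H₀ + (c : ℂ) • H₁) y⟫_ℂ := by
  change ⟪H₀ ⟨x, x.2.1⟩ + (c : ℂ) • H₁ ⟨x, x.2.2⟩, (y : 𝓗)⟫_ℂ =
    ⟪(x : 𝓗), H₀ ⟨y, y.2.1⟩ + (c : ℂ) • H₁ ⟨y, y.2.2⟩⟫_ℂ
  rw [inner_add_left, inner_add_right, inner_smul_left, inner_smul_right, Complex.conj_ofReal]
  congr 1
  · exact h.symm₀ ⟨x, x.2.1⟩ ⟨y, y.2.1⟩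
  · congr 1
    exact h.symm₁ ⟨x, x.2.2⟩ ⟨y, y.2.2⟩

/-- A relative operator bound of `c H₁` with respect to `H₀` is also a relative form bound, with
the same constant: the self-adjoint operator `c H₀^{-1/2} H₁ H₀^{-1/2}` has the same non-zero
spectrum as `c H₁ H₀⁻¹`. -/
theorem norm_smul_mul_le [Nontrivial 𝓗] (h : PerturbationData H₀ H₁ γ₀ B₀ W) (c : ℝ) :
    ‖(c : ℂ) • (B₀ * W)‖ ≤ ‖(c : ℂ) • (W * B₀)‖ := by
  have hsa : IsSelfAdjoint ((c : ℂ) • (B₀ * W)) := by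
    rw [ContinuousLinearMap.isSelfAdjoint_iff_isSymmetric]
    intro x y
    change ⟪(c : ℂ) • B₀ (W x), y⟫_ℂ = ⟪x, (c : ℂ) • B₀ (W y)⟫_ℂ
    rw [inner_smul_left, inner_smul_right, Complex.conj_ofReal,
      inner_apply_left_of_isSelfAdjoint h.invSqrt.selfAdjoint, h.inner_apply,
      inner_apply_left_of_isSelfAdjoint h.invSqrt.selfAdjoint]
  have hrad : spectralRadius ℂ ((c : ℂ) • (B₀ * W)) ≤ ‖(c : ℂ) • (W * B₀)‖₊ := by
    refine iSup₂_le fun k hk => ?_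
    rw [ENNReal.coe_le_coe]
    rcases eq_or_ne k 0 with rfl | hk0
    · simp
    · have h1 : k ∈ spectrum ℂ (((c : ℂ) • W) * B₀) \ {0} := by
        rw [spectrum.nonzero_mul_comm, mul_smul_comm]
        exact ⟨hk, hk0⟩
      rw [smul_mul_assoc] at h1
      exact spectrum.norm_le_norm_of_mem h1.1
  rw [hsa.spectralRadius_eq_nnnorm] at hrad
  exact_mod_cast hrad

theorem ge_one [Nontrivial 𝓗] (h : PerturbationData H₀ H₁ γ₀ B₀ W) {c δ : ℝ}
    (hγ₀ : 0 < γ₀) (hδ : ‖(c : ℂ) • (W * B₀)‖ ≤ δ) (hδγ : (3 * γ₀ + 1) / γ₀ * δ < 1)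
    (ψ : (H₀ + (c : ℂ) • H₁).domain) :
    ‖(ψ : 𝓗)‖ ^ 2 ≤ (inner ℂ (ψ : 𝓗) ((H₀ + (c : ℂ) • H₁) ψ)).re := by
  have hδ0 : 0 ≤ δ := (norm_nonneg _).trans hδ
  obtain ⟨x, hx⟩ := ψ
  obtain ⟨z, rfl⟩ := h.exists_eq_sq hx.1
  obtain ⟨h1, h2⟩ := h.add_smul_apply_sq c z
  obtain ⟨h3, h4⟩ := h.invSqrt.inverse.1 z
  have h5 := h.ge ⟨_, h3⟩
  rw [h4] at h5
  rw [h2]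
  change (1 + γ₀) * ‖(B₀ ^ 2) z‖ ^ 2 ≤ (inner ℂ ((B₀ ^ 2) z) z).re at h5
  change ‖(B₀ ^ 2) z‖ ^ 2 ≤ (inner ℂ ((B₀ ^ 2) z) (z + (c : ℂ) • W (B₀ z))).re
  have hsa := h.invSqrt.selfAdjoint
  have e1 : ⟪(B₀ ^ 2) z, z⟫_ℂ = ((‖B₀ z‖ ^ 2 : ℝ) : ℂ) := by
    rw [norm_sq_apply_of_isSelfAdjoint hsa, inner_pow_left_of_isSelfAdjoint hsa, pow_two]
  have e2 : ⟪(B₀ ^ 2) z, (c : ℂ) • W (B₀ z)⟫_ℂ = ⟪B₀ z, ((c : ℂ) • (B₀ * W)) (B₀ z)⟫_ℂ := by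
    rw [pow_two, mul_apply_eq_comp, inner_apply_left_of_isSelfAdjoint hsa, map_smul]
    rfl
  have h6 : -(δ * ‖B₀ z‖ ^ 2) ≤ (⟪(B₀ ^ 2) z, (c : ℂ) • W (B₀ z)⟫_ℂ).re := by
    rw [e2]
    refine neg_le_of_abs_le ((Complex.abs_re_le_norm _).trans ((norm_inner_le_norm _ _).trans ?_))
    calc _ ≤ ‖B₀ z‖ * (δ * ‖B₀ z‖) := by
          gcongr
          exact ContinuousLinearMap.le_of_opNorm_le _ ((h.norm_smul_mul_le c).trans hδ) _
      _ = _ := by ring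
  rw [e1, Complex.ofReal_re] at h5
  rw [inner_add_right, Complex.add_re, e1, Complex.ofReal_re]
  have h7 : (3 * γ₀ + 1) * δ < γ₀ := by
    rwa [div_mul_eq_mul_div, div_lt_one hγ₀] at hδγ
  have h8 : δ ≤ 1 := by nlinarith
  -- `(1 - δ) (1 + γ₀) ≥ 1`, as `δ < γ₀ / (3 γ₀ + 1) ≤ γ₀ / (1 + γ₀)`
  have h9 : 1 ≤ (1 - δ) * (1 + γ₀) := by nlinarith
  have h10 := mul_le_mul_of_nonneg_left h5 (sub_nonneg.2 h8)
  have h11 := mul_le_mul_of_nonneg_right h9 (sq_nonneg ‖(B₀ ^ 2) z‖)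
  nlinarith

theorem isUnit (W B₀ : 𝓗 →L[ℂ] 𝓗) {c : ℂ} (hc : ‖c • (W * B₀)‖ < 1) :
    IsUnit (1 + c • (W * B₀)) := by
  have := isUnit_one_sub_of_norm_lt_one (x := -(c • (W * B₀))) (by rwa [norm_neg])
  rwa [sub_neg_eq_add] at this

/-- The resolvent `H(c)⁻¹` of `H(c) = H₀ + c H₁` has derivative `-H(c)⁻¹ H₁ H(c)⁻¹` in `c`. -/
theorem hasDerivAt_resolvent (W B₀ : 𝓗 →L[ℂ] 𝓗) {c : ℝ → ℝ} {c' t : ℝ}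
    (hc : HasDerivAt c c' t) (hu : IsUnit (1 + (c t : ℂ) • (W * B₀))) :
    HasDerivAt (fun s => B₀ ^ 2 * Ring.inverse (1 + (c s : ℂ) • (W * B₀)))
      (((-c' : ℝ) : ℂ) • (B₀ ^ 2 * Ring.inverse (1 + (c t : ℂ) • (W * B₀)) *
        (W * B₀ * Ring.inverse (1 + (c t : ℂ) • (W * B₀))))) t := by
  obtain ⟨u, hu⟩ := hu
  have h1 : HasDerivAt (fun s => 1 + (c s : ℂ) • (W * B₀)) ((c' : ℂ) • (W * B₀)) t :=
    (hc.ofReal_comp.smul_const (W * B₀)).const_add 1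
  have h2 := hasFDerivAt_ringInverse (𝕜 := ℝ) u
  rw [hu] at h2
  have h3 := (h2.comp_hasDerivAt t h1).const_mul (B₀ ^ 2)
  refine h3.congr_deriv ?_
  rw [← hu, Ring.inverse_unit]
  simp [mul_assoc]

end PerturbationData

end

section

variable {𝓗 : Type*} [NormedAddCommGroup 𝓗] [InnerProductSpace ℂ 𝓗]

/-! ### The form bounds for the perturbed operator -/

theorem PerturbationData.add_inverse_apply {B₀ W : 𝓗 →L[ℂ] 𝓗} {c : ℂ}
    (hu : IsUnit (1 + c • (W * B₀))) (y : 𝓗) :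
    Ring.inverse (1 + c • (W * B₀)) y +
      c • W (B₀ (Ring.inverse (1 + c • (W * B₀)) y)) = y := by
  have h := congrArg (fun T : 𝓗 →L[ℂ] 𝓗 => T y) (Ring.mul_inverse_cancel _ hu)
  exact h

variable [CompleteSpace 𝓗]

namespace PerturbationData

variable {H₀ H₁ : 𝓗 →ₗ.[ℂ] 𝓗} {γ₀ : ℝ} {B₀ W : 𝓗 →L[ℂ] 𝓗}

/-- The operator `H₁` is bounded relative to `H(c)^{1/2}`, where `H(c) = H₀ + c H₁`: with
`ψ = H(c)⁻¹ y` one has `‖H₀^{1/2} ψ‖² = ⟪ψ, H(c) ψ⟫ - c ⟪ψ, H₁ ψ⟫`, hence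
`‖H₀^{1/2} ψ‖ ≤ (1 + |c| p) ‖H(c)^{1/2} ψ‖`. -/
theorem norm_mul_inverse_le (h : PerturbationData H₀ H₁ γ₀ B₀ W) {c q a b p : ℝ} (ha : 0 ≤ a)
    (hb : 0 ≤ b) (hab : ∀ x, ‖W x‖ ≤ a * ‖x‖ + b * ‖B₀ x‖) (hp : ∀ x, ‖W x‖ ≤ p * ‖x‖)
    (hq0 : 0 ≤ q) (hq : |c| * p ≤ q) (hu : IsUnit (1 + (c : ℂ) • (W * B₀))) {B : 𝓗 →L[ℂ] 𝓗}
    (hB : IsInvSqrt (H₀ + (c : ℂ) • H₁) B)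
    (hBR : B ^ 2 = B₀ ^ 2 * Ring.inverse (1 + (c : ℂ) • (W * B₀))) (y : 𝓗) :
    ‖(W * B₀ * Ring.inverse (1 + (c : ℂ) • (W * B₀))) y‖ ≤ (a + b + a * q) * ‖B y‖ := by
  have hsa := h.invSqrt.selfAdjoint
  obtain ⟨z, hz⟩ : ∃ z, z = Ring.inverse (1 + (c : ℂ) • (W * B₀)) y := ⟨_, rfl⟩
  have hy := add_inverse_apply hu y
  rw [← hz] at hy
  have hGy : (W * B₀ * Ring.inverse (1 + (c : ℂ) • (W * B₀))) y = W (B₀ z) := by rw [hz]; rfl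
  have hRy : (B ^ 2) y = B₀ (B₀ z) := by rw [hBR, hz, pow_two B₀]; rfl
  have hRle : ‖B₀ (B₀ z)‖ ≤ ‖B y‖ := by
    rw [← hRy, pow_two, mul_apply_eq_comp]
    exact hB.norm_le _
  have hsq : ((‖B₀ z‖ ^ 2 : ℝ) : ℂ) = ((‖B y‖ ^ 2 : ℝ) : ℂ) - c * ⟪W (B₀ z), B₀ (B₀ z)⟫_ℂ := by
    rw [norm_sq_apply_of_isSelfAdjoint hsa, norm_sq_apply_of_isSelfAdjoint hB.selfAdjoint,
      ← pow_two B, hRy, mul_apply_eq_comp]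
    conv_rhs => rw [← hy]
    rw [inner_add_left, inner_smul_left, Complex.conj_ofReal, add_sub_cancel_right]
  have hχ : ‖B₀ z‖ ^ 2 ≤ ‖B y‖ ^ 2 + q * ‖B₀ z‖ * ‖B y‖ := by
    have h1 : ‖((‖B₀ z‖ ^ 2 : ℝ) : ℂ)‖ ≤
        ‖B y‖ ^ 2 + |c| * (‖W (B₀ z)‖ * ‖B₀ (B₀ z)‖) := by
      rw [hsq]
      refine (norm_sub_le _ _).trans (add_le_add ?_ ?_)
      · rw [Complex.norm_real, Real.norm_of_nonneg (sq_nonneg _)]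
      · rw [norm_mul, Complex.norm_real, Real.norm_eq_abs]
        exact mul_le_mul_of_nonneg_left (norm_inner_le_norm _ _) (abs_nonneg c)
    rw [Complex.norm_real, Real.norm_of_nonneg (sq_nonneg _)] at h1
    refine h1.trans (add_le_add_right ?_ _)
    calc |c| * (‖W (B₀ z)‖ * ‖B₀ (B₀ z)‖) ≤ |c| * (p * ‖B₀ z‖ * ‖B y‖) := by
          gcongr ?_ * ?_
          exact mul_le_mul (hp _) hRle (norm_nonneg _) ((norm_nonneg _).trans (hp _))
      _ = |c| * p * (‖B₀ z‖ * ‖B y‖) := by ring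
      _ ≤ q * (‖B₀ z‖ * ‖B y‖) := by gcongr
      _ = _ := by ring
  have hχ' : ‖B₀ z‖ ≤ (1 + q) * ‖B y‖ := by
    by_contra! hlt
    have h0 := norm_nonneg (B y)
    have h1 := norm_nonneg (B₀ z)
    have h2 : ‖B y‖ ≤ ‖B₀ z‖ - q * ‖B y‖ := by linarith
    rcases eq_or_lt_of_le h0 with h3 | h3
    · rw [← h3] at hχ hlt
      nlinarith
    · have h4 := mul_le_mul_of_nonneg_left h2 h1
      have h5 : ‖B y‖ < ‖B₀ z‖ := by nlinarith
      nlinarith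
  rw [hGy]
  calc _ ≤ _ := hab _
    _ ≤ a * ((1 + q) * ‖B y‖) + b * ‖B y‖ := by gcongr
    _ = _ := by ring

/-- The form of the commutator, on vectors `H(c)⁻¹ p` and `H(c)⁻¹ v`; it does not depend on `c`, as
`[H₁, H₀ + c H₁] = [H₁, H₀]`. -/
theorem exists_commutator_apply (h : PerturbationData H₀ H₁ γ₀ B₀ W) {c : ℝ}
    (hu : IsUnit (1 + (c : ℂ) • (W * B₀))) {B : 𝓗 →L[ℂ] 𝓗}
    (hBR : B ^ 2 = B₀ ^ 2 * Ring.inverse (1 + (c : ℂ) • (W * B₀))) {K : 𝓗 →ₗ.[ℂ] 𝓗}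
    (hK : IsCommutator H₁ H₀ K) (v : 𝓗) :
    ∃ hv : (B ^ 2) v ∈ K.domain, ∀ p, ⟪(B ^ 2) p, K ⟨(B ^ 2) v, hv⟩⟫_ℂ =
      ⟪(W * B₀ * Ring.inverse (1 + (c : ℂ) • (W * B₀))) p, v⟫_ℂ -
      ⟪p, (W * B₀ * Ring.inverse (1 + (c : ℂ) • (W * B₀))) v⟫_ℂ := by
  obtain ⟨-, h₁, hK', hform⟩ := hK
  have hmem : ∀ y, ∃ h0 : (B ^ 2) y ∈ H₀.domain,
      H₀ ⟨(B ^ 2) y, h0⟩ = Ring.inverse (1 + (c : ℂ) • (W * B₀)) y := fun y => by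
    rw [hBR]
    exact h.invSqrt.inverse.1 _
  have hmem₁ : ∀ y, ∃ h1 : (B ^ 2) y ∈ H₁.domain, H₁ ⟨(B ^ 2) y, h1⟩ =
      (W * B₀ * Ring.inverse (1 + (c : ℂ) • (W * B₀))) y := fun y => by
    rw [hBR, pow_two]
    exact h.apply_eq _
  obtain ⟨hv, hv'⟩ := hmem v
  obtain ⟨hv₁, hv₁'⟩ := hmem₁ v
  refine ⟨hK' hv, fun p => ?_⟩
  obtain ⟨hp, hp'⟩ := hmem p
  obtain ⟨hp₁, hp₁'⟩ := hmem₁ p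
  have hf := hform ⟨_, hp⟩ ⟨_, hv⟩
  rw [hv', hv₁', hp', hp₁'] at hf
  refine hf.trans ?_
  have ep := add_inverse_apply hu p
  have ev := add_inverse_apply hu v
  change Ring.inverse (1 + (c : ℂ) • (W * B₀)) p +
    (c : ℂ) • (W * B₀ * Ring.inverse (1 + (c : ℂ) • (W * B₀))) p = p at ep
  change Ring.inverse (1 + (c : ℂ) • (W * B₀)) v +
    (c : ℂ) • (W * B₀ * Ring.inverse (1 + (c : ℂ) • (W * B₀))) v = v at ev
  rw [eq_sub_of_add_eq ep, eq_sub_of_add_eq ev, inner_sub_left, inner_sub_right, inner_smul_left,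
    inner_smul_right, Complex.conj_ofReal]
  ring

end PerturbationData

/-- The norm of `H^{-k/2} K H^{(k-2)/2}`, evaluated on the vectors `H^{-k/2} v`. -/
theorem NormLE.norm_commutator_le {H K : 𝓗 →ₗ.[ℂ] 𝓗} {B : 𝓗 →L[ℂ] 𝓗} (hB : IsInvSqrt H B)
    {k : ℕ} (hk : 1 ≤ k) {E : ℝ}
    (h : NormLE (pcomp (halfPow H (-(k : ℤ))) (pcomp K (halfPow H (-(-(k : ℤ) + 2))))) E)
    {v : 𝓗} (hv : (B ^ 2) v ∈ K.domain) :
    ‖(B ^ k) (K ⟨(B ^ 2) v, hv⟩)‖ ≤ E * ‖(B ^ k) v‖ := by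
  rw [show -(-(k : ℤ) + 2) = (k : ℤ) - 2 by ring] at h
  obtain ⟨h1, h2⟩ := mem_pcomp_domain
    (mem_pcomp_domain (halfPow_sub_two_apply hB.sqrt_eq hB.injective hk v) ⟨hv, rfl⟩)
    (halfPow_neg_apply hB.sqrt_eq k _)
  rw [← h2]
  exact h.2 ⟨_, h1⟩

theorem PerturbationData.formBounds [Nontrivial 𝓗] {H₀ H₁ : 𝓗 →ₗ.[ℂ] 𝓗} {γ₀ : ℝ}
    {B₀ W : 𝓗 →L[ℂ] 𝓗} (h : PerturbationData H₀ H₁ γ₀ B₀ W) {c q a b p : ℝ} (ha : 0 ≤ a)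
    (hb : 0 ≤ b) (hab : ∀ x, ‖W x‖ ≤ a * ‖x‖ + b * ‖B₀ x‖) (hp : ∀ x, ‖W x‖ ≤ p * ‖x‖)
    (hq0 : 0 ≤ q) (hq : |c| * p ≤ q) (hu : IsUnit (1 + (c : ℂ) • (W * B₀))) {B : 𝓗 →L[ℂ] 𝓗}
    (hB : IsInvSqrt (H₀ + (c : ℂ) • H₁) B)
    (hBR : B ^ 2 = B₀ ^ 2 * Ring.inverse (1 + (c : ℂ) • (W * B₀))) {K : 𝓗 →ₗ.[ℂ] 𝓗} {m : ℕ}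
    {e : ℕ → ℝ} (hK : ∀ k : ℕ, 1 ≤ k → k ≤ m → IsCommutator H₁ H₀ K ∧
      NormLE (pcomp (halfPow (H₀ + (c : ℂ) • H₁) (-(k : ℤ)))
        (pcomp K (halfPow (H₀ + (c : ℂ) • H₁) (-(-(k : ℤ) + 2))))) (e k)) :
    FormBounds B (W * B₀ * Ring.inverse (1 + (c : ℂ) • (W * B₀))) (a + b + a * q) e m where
  selfAdjoint := hB.selfAdjoint
  norm_le := hB.norm_le
  symm x y := by
    rw [hBR, pow_two]
    exact (h.inner_apply _ _).symm
  A_nonneg := by positivity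
  e_nonneg k hk hkm := by
    obtain ⟨v, hv⟩ := exists_ne (0 : 𝓗)
    obtain ⟨hv', -⟩ := h.exists_commutator_apply hu hBR (hK k hk hkm).1 v
    have h1 := (norm_nonneg _).trans ((hK k hk hkm).2.norm_commutator_le hB hk hv')
    have h2 : (B ^ k) v ≠ 0 := by
      rw [FunLike.coe_pow_eq_iterate]
      intro h0
      refine hv (hB.injective.iterate k (h0.trans ?_))
      rw [← FunLike.coe_pow_eq_iterate, map_zero]
    exact nonneg_of_mul_nonneg_left h1 (norm_pos_iff.2 h2)
  bound := h.norm_mul_inverse_le ha hb hab hp hq0 hq hu hB hBR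
  comm hm v := by
    obtain ⟨hv, hv'⟩ := h.exists_commutator_apply hu hBR (hK 1 le_rfl hm).1 v
    exact ⟨_, hv', fun k hk hkm => (hK k hk hkm).2.norm_commutator_le hB hk hv⟩

end

section

variable {𝓗 : Type*} [NormedAddCommGroup 𝓗] [InnerProductSpace ℂ 𝓗]

/-! ### Growth along the propagator -/

theorem hasDerivAt_inner_apply_self {R : ℝ → 𝓗 →L[ℂ] 𝓗} {D : 𝓗 →L[ℂ] 𝓗} {u : ℝ → 𝓗} {u' : 𝓗}
    {t : ℝ} (hR : HasDerivAt R D t) (hu : HasDerivAt u u' t) :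
    HasDerivAt (fun s => ⟪u s, R s (u s)⟫_ℂ)
      (⟪u t, D (u t) + R t u'⟫_ℂ + ⟪u', R t (u t)⟫_ℂ) t := by
  have h1 : HasDerivAt (fun s => (R s).restrictScalars ℝ) (D.restrictScalars ℝ) t :=
    (ContinuousLinearMap.restrictScalarsL ℂ 𝓗 𝓗 ℝ ℝ).hasFDerivAt.comp_hasDerivAt t hR
  exact hu.inner ℂ (h1.clm_apply hu)

variable [CompleteSpace 𝓗]

/-- The growth estimate. For `x` in the domain, `F(t) = ‖H(t)^{-m/2} U(t, r) x‖²` is the expectation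
of `H(t)^{-m}` in the evolved vector. The generator commutes with `H(t)^{-m}`, so only the change
of `H(t)^{-m}` in time contributes to `F'`, and that derivative is a form bounded by `H(t)^{-m}` itself. -/
theorem IsUnitaryPropagator.norm_pow_apply_le {g : ℝ → ℝ} (hg : ContDiff ℝ 1 g)
    (hg' : tsupport (deriv g) ⊆ Set.Ioo 0 1) {ε η : ℝ} (hε : 0 < ε) (hη : 0 < η)
    {A : ℝ → 𝓗 →ₗ.[ℂ] 𝓗} {D : Submodule ℂ 𝓗} (hD : Dense (D : Set 𝓗))
    {U : ℝ → ℝ → 𝓗 →L[ℂ] 𝓗} (hU : IsUnitaryPropagator A D U) {B G : ℝ → 𝓗 →L[ℂ] 𝓗}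
    (hB : ∀ t, IsInvSqrt (A t) (B t))
    (hB' : ∀ t, HasDerivAt (fun s => B s ^ 2)
      (((-(ε * (deriv g (η * t) * η)) : ℝ) : ℂ) • (B t ^ 2 * G t)) t)
    {C : ℝ} {e : ℕ → ℝ} {m : ℕ} (hF : ∀ t, FormBounds (B t) (G t) C e m) (t r : ℝ) (x : 𝓗) :
    ‖(B t ^ m) (U t r x)‖ ≤
      Real.exp (ε * maxAbs (deriv g) * ∑ j ∈ Finset.range m, formConst C e j) *
        ‖(B r ^ m) x‖ := by
  have hsum : 0 ≤ ∑ j ∈ Finset.range m, formConst C e j :=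
    Finset.sum_nonneg fun j hj => (hF 0).formConst_nonneg (Finset.mem_range.1 hj).le
  refine isClosed_property hD.denseRange_val
    (p := fun x => ‖(B t ^ m) (U t r x)‖ ≤ _ * ‖(B r ^ m) x‖)
    (isClosed_le (by fun_prop) (by fun_prop)) ?_ x
  rintro ⟨x, hx⟩
  rcases eq_or_ne x 0 with rfl | hx0
  · simp
  have hsa : ∀ s (i : ℕ) (y z : 𝓗), ⟪(B s ^ i) y, z⟫_ℂ = ⟪y, (B s ^ i) z⟫_ℂ := fun s =>
    inner_pow_left_of_isSelfAdjoint (hB s).selfAdjoint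
  have hpow : ∀ s (y : 𝓗), ((‖(B s ^ m) y‖ ^ 2 : ℝ) : ℂ) = ⟪y, ((B s ^ 2) ^ m) y⟫_ℂ := by
    intro s y
    rw [norm_sq_apply_of_isSelfAdjoint ((hB s).selfAdjoint.pow m), ← pow_two, ← pow_mul,
      ← pow_mul, mul_comm]
  have hinj : ∀ s, Function.Injective (B s ^ m : 𝓗 →L[ℂ] 𝓗) := fun s => by
    rw [FunLike.coe_pow_eq_iterate]
    exact (hB s).injective.iterate m
  have hder : ∀ s, ∃ F', HasDerivAt (fun s => ‖(B s ^ m) (U s r x)‖ ^ 2) F' s ∧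
      |F'| ≤ 2 * ε * (∑ j ∈ Finset.range m, formConst C e j) * |η * deriv g (η * s)| *
        ‖(B s ^ m) (U s r x)‖ ^ 2 := by
    intro s
    obtain ⟨D', hD', hbd⟩ := (hF s).exists_hasDerivAt_pow (R := fun s => B s ^ 2) rfl (hB' s) m
      le_rfl
    obtain ⟨hdom, hUs⟩ := hU.hasDerivAt_left s r x hx
    have h1 := hasDerivAt_inner_apply_self hD' hUs
    obtain ⟨y, hy⟩ : ∃ y, y = A s ⟨U s r x, hdom⟩ := ⟨_, rfl⟩
    have hy' : (B s ^ 2) y = U s r x := by rw [hy]; exact (hB s).inverse.2 ⟨_, hdom⟩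
    -- the two terms with the generator cancel, since `H(s)` commutes with its powers
    have hcancel : ⟪U s r x, ((B s ^ 2) ^ m) (-Complex.I • y)⟫_ℂ +
        ⟪-Complex.I • y, ((B s ^ 2) ^ m) (U s r x)⟫_ℂ = 0 := by
      rw [← hy', map_smul, inner_smul_right, inner_smul_left, hsa, ← mul_apply_eq_comp,
        ← mul_apply_eq_comp, ← pow_succ, ← pow_succ']
      simp
    rw [← hy, inner_add_right, add_assoc, hcancel, add_zero] at h1
    refine ⟨(⟪U s r x, D' (U s r x)⟫_ℂ).re, ?_, ?_⟩
    · have h2 := Complex.reCLM.hasFDerivAt.comp_hasDerivAt s h1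
      refine h2.congr_of_eventuallyEq (Filter.Eventually.of_forall fun s' => ?_)
      change _ = (⟪U s' r x, ((B s' ^ 2) ^ m) (U s' r x)⟫_ℂ).re
      rw [← hpow, Complex.ofReal_re]
    · refine (Complex.abs_re_le_norm _).trans ((hbd _).trans (le_of_eq ?_))
      rw [abs_neg, abs_mul, abs_of_pos hε, mul_comm η (deriv g (η * s))]
      ring
  choose F' hF' hF'bd using hder
  have hmain := le_exp_mul_of_abs_deriv_le hg hg' hη
    (κ := 2 * ε * ∑ j ∈ Finset.range m, formConst C e j) (by positivity)
    (fun s => by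
      have hne : (B s ^ m) (U s r x) ≠ 0 := by
        intro h0
        have h1 := hinj s (h0.trans (map_zero _).symm)
        have h2 := hU.comp r s r
        rw [hU.self] at h2
        have h3 := congrArg (fun T : 𝓗 →L[ℂ] 𝓗 => T x) h2
        change U r s (U s r x) = x at h3
        rw [h1, map_zero] at h3
        exact hx0 h3.symm
      positivity) hF' hF'bd t r
  refine (sq_le_sq₀ (norm_nonneg _) (by positivity)).1 (hmain.trans (le_of_eq ?_))
  rw [hU.self, mul_pow, ← Real.exp_nat_mul]
  congr 2
  push_cast
  ring

/-! ### Duality -/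

/-- A vector `v` with `|⟪v, x⟫| ≤ C ‖B x‖` lies in the range of the self-adjoint operator `B`. -/
theorem exists_apply_eq_of_norm_inner_le {B : 𝓗 →L[ℂ] 𝓗} (hB : IsSelfAdjoint B)
    (hinj : Function.Injective B) {v : 𝓗} {C : ℝ} (hC : 0 ≤ C)
    (h : ∀ x, ‖⟪v, x⟫_ℂ‖ ≤ C * ‖B x‖) : ∃ z, B z = v ∧ ‖z‖ ≤ C := by
  let L := LinearEquiv.ofInjective (B : 𝓗 →ₗ[ℂ] 𝓗) hinj
  let f : LinearMap.range (B : 𝓗 →ₗ[ℂ] 𝓗) →ₗ[ℂ] ℂ := (innerₛₗ ℂ v).comp L.symm.toLinearMap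
  have hL : ∀ y, B (L.symm y) = y := fun y => congrArg Subtype.val (L.apply_symm_apply y)
  have hf : ∀ y, ‖f y‖ ≤ C * ‖y‖ := fun y => by
    have := h (L.symm y)
    rw [hL] at this
    exact this
  obtain ⟨F, hF, hFn⟩ := exists_extension_norm_eq _ (f.mkContinuous C hf)
  refine ⟨(InnerProductSpace.toDual ℂ 𝓗).symm F, ?_, ?_⟩
  · refine ext_inner_right ℂ fun x => ?_
    rw [inner_apply_left_of_isSelfAdjoint hB, InnerProductSpace.toDual_symm_apply]
    have h1 := hF (L x)
    have h2 : f (L x) = ⟪v, x⟫_ℂ := by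
      change ⟪v, L.symm (L x)⟫_ℂ = _
      rw [L.symm_apply_apply]
    exact h1.trans h2
  · rw [LinearIsometryEquiv.norm_map, hFn]
    exact f.mkContinuous_norm_le hC hf

theorem IsUnitaryPropagator.inner_apply_left {A : ℝ → 𝓗 →ₗ.[ℂ] 𝓗} {D : Submodule ℂ 𝓗}
    {U : ℝ → ℝ → 𝓗 →L[ℂ] 𝓗} (hU : IsUnitaryPropagator A D U) (t r : ℝ) (x y : 𝓗) :
    ⟪U t r x, y⟫_ℂ = ⟪x, U r t y⟫_ℂ := by
  have h2 := hU.comp t r t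
  rw [hU.self] at h2
  have h3 := congrArg (fun T : 𝓗 →L[ℂ] 𝓗 => T y) h2
  change U t r (U r t y) = y at h3
  conv_lhs => rw [← h3]
  exact ContinuousLinearMap.inner_map_map_of_mem_unitary (hU.unitary_mem t r) _ _

/-- The bound on `H(t)^{-m/2} U(t, r) H(r)^{m/2}` for all `t` and `r`, in the form
`‖H(t)^{-m/2} U(t, r) x‖ ≤ C ‖H(r)^{-m/2} x‖`, gives the bounds on
`H(t)^{-m/2} U(t, r) H(r)^{m/2}` and on `H(t)^{m/2} U(t, r) H(r)^{-m/2}`, the adjoint of the former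
with `t` and `r` exchanged. -/
theorem IsUnitaryPropagator.normLE {A : ℝ → 𝓗 →ₗ.[ℂ] 𝓗} {D : Submodule ℂ 𝓗}
    {U : ℝ → ℝ → 𝓗 →L[ℂ] 𝓗} (hU : IsUnitaryPropagator A D U) {B : ℝ → 𝓗 →L[ℂ] 𝓗}
    (hB : ∀ t, IsInvSqrt (A t) (B t)) {C : ℝ} (hC : 0 ≤ C) (n : ℤ)
    (h : ∀ t r x, ‖(B t ^ n.natAbs) (U t r x)‖ ≤ C * ‖(B r ^ n.natAbs) x‖) (t r : ℝ) :
    NormLE (pcomp (halfPow (A t) (-n)) (pcomp (ofBounded (U t r)) (halfPow (A r) n))) C := by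
  have hinj : ∀ s (m : ℕ), Function.Injective (B s ^ m : 𝓗 →L[ℂ] 𝓗) := fun s m => by
    rw [FunLike.coe_pow_eq_iterate]
    exact (hB s).injective.iterate m
  obtain ⟨m, rfl | rfl⟩ := n.eq_nat_or_neg
  · rw [Int.natAbs_natCast] at h
    have key : ∀ x, ∃ hx : (B r ^ m) x ∈ (pcomp (halfPow (A t) (-(m : ℤ)))
        (pcomp (ofBounded (U t r)) (halfPow (A r) m))).domain,
        pcomp (halfPow (A t) (-(m : ℤ))) (pcomp (ofBounded (U t r)) (halfPow (A r) m))
          ⟨(B r ^ m) x, hx⟩ = (B t ^ m) (U t r x) := fun x =>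
      mem_pcomp_domain (mem_pcomp_domain
        (halfPow_natCast_apply (hB r).sqrt_eq (hB r).injective m x) (ofBounded_apply _ _))
        (halfPow_neg_apply (hB t).sqrt_eq m _)
    constructor
    · refine (denseRange_of_isSelfAdjoint_of_injective ((hB r).selfAdjoint.pow m)
        (hinj r m)).mono ?_
      rintro _ ⟨x, rfl⟩
      exact (key x).1
    · rintro ⟨ψ, hψ⟩
      obtain ⟨x, rfl⟩ := (mem_halfPow_natCast_domain (hB r).sqrt_eq m ψ).1 hψ.1.1
      obtain ⟨_, h2⟩ := key x
      rw [h2]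
      exact h t r x
  · rw [Int.natAbs_neg, Int.natAbs_natCast] at h
    rw [neg_neg]
    have key : ∀ x, ∃ hx : x ∈ (pcomp (halfPow (A t) (m : ℤ))
        (pcomp (ofBounded (U t r)) (halfPow (A r) (-(m : ℤ))))).domain,
        ‖pcomp (halfPow (A t) (m : ℤ)) (pcomp (ofBounded (U t r)) (halfPow (A r) (-(m : ℤ))))
          ⟨x, hx⟩‖ ≤ C * ‖x‖ := fun x => by
      obtain ⟨z, hz, hz'⟩ := exists_apply_eq_of_norm_inner_le ((hB t).selfAdjoint.pow m) (hinj t m)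
        (v := U t r ((B r ^ m) x)) (C := C * ‖x‖) (by positivity) fun y => by
          rw [hU.inner_apply_left, inner_pow_left_of_isSelfAdjoint (hB r).selfAdjoint]
          calc _ ≤ _ := norm_inner_le_norm _ _
            _ ≤ ‖x‖ * (C * ‖(B t ^ m) y‖) := by gcongr; exact h r t y
            _ = _ := by ring
      have h1 := halfPow_natCast_apply (hB t).sqrt_eq (hB t).injective m z
      rw [hz] at h1
      obtain ⟨h2, h3⟩ := mem_pcomp_domain (mem_pcomp_domain
        (halfPow_neg_apply (hB r).sqrt_eq m x) (ofBounded_apply (U t r) _)) h1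
      exact ⟨h2, by rw [h3]; exact hz'⟩
    exact ⟨by convert dense_univ; exact Set.eq_univ_of_forall fun x => (key x).1,
      fun ψ => (key ψ).2⟩

/-! ### The constants -/

/-- The factor from the growth estimate is at most the recursively defined constant, because all
the constants `C_j` are at least `1`. -/
theorem exp_sum_le_energyConst {α β ε C M' : ℝ} {γ : ℕ → ℝ} {e : ℕ → ℝ} {m : ℕ} (hε : 0 < ε)
    (hM' : 0 ≤ M') (hC : 0 ≤ C) (he : ∀ k, 1 ≤ k → k ≤ m → 0 ≤ e k) (hα : α + β * ε = M' * C)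
    (hγ : ∀ k, γ k = M' * ∑ i ∈ Finset.Icc 1 k, e i) :
    Real.exp (ε * M' * ∑ j ∈ Finset.range m, formConst C e j) ≤ energyConst α β γ ε m := by
  have hnn : ∀ k ≤ m, 0 ≤ formConst C e k := fun k hk =>
    add_nonneg hC (Finset.sum_nonneg fun i hi =>
      he i (Finset.mem_Icc.1 hi).1 ((Finset.mem_Icc.1 hi).2.trans hk))
  suffices H : ∀ k ≤ m, Real.exp (ε * M' * ∑ j ∈ Finset.range k, formConst C e j) ≤
      energyConst α β γ ε k from H m le_rfl
  intro k
  induction k with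
  | zero => intro; simp [energyConst]
  | succ k ih =>
    intro hk
    have h1 := ih (by omega)
    have h2 : 1 ≤ energyConst α β γ ε k := by
      refine le_trans (Real.one_le_exp ?_) h1
      refine mul_nonneg (by positivity) (Finset.sum_nonneg fun j hj => hnn j ?_)
      have := Finset.mem_range.1 hj
      omega
    have h3 : α + β * ε + γ (k + 1) = M' * formConst C e (k + 1) := by
      rw [hα, hγ, formConst]
      ring
    have h4 := formConst_mono (A := C) he (Nat.le_succ k) hk
    have h5 := hnn (k + 1) hk
    rw [energyConst, h3, Finset.sum_range_succ, mul_add, Real.exp_add]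
    have h6 : ε * M' * formConst C e k ≤
        energyConst α β γ ε k * (M' * formConst C e (k + 1)) * ε := by
      calc _ ≤ ε * M' * formConst C e (k + 1) := by gcongr
        _ ≤ energyConst α β γ ε k * (ε * M' * formConst C e (k + 1)) :=
          le_mul_of_one_le_left (by positivity) h2
        _ = _ := by ring
    have h7 : 0 ≤ energyConst α β γ ε k := zero_le_one.trans h2
    gcongr

end

end EnergyEstimate

open EnergyEstimate in
theorem mainTheorem1 {𝓗 : Type*} [NormedAddCommGroup 𝓗] [InnerProductSpace ℂ 𝓗]
    [CompleteSpace 𝓗] [TopologicalSpace.SeparableSpace 𝓗]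
    (H₀ H₁ : 𝓗 →ₗ.[ℂ] 𝓗) (g : ℝ → ℝ) (γ₀ a b εs : ℝ)
    -- the switching function
    (hg : ContDiff ℝ 1 g) (hg' : tsupport (deriv g) ⊆ Set.Ioo 0 1) (hg0 : ∀ s < 0, g s = 0)
    -- `H₀` is self-adjoint with `H₀ ≥ 1 + γ₀`
    (hγ₀ : 0 < γ₀) (hH₀ : IsSelfAdjoint H₀)
    (hH₀_ge : ∀ ψ : H₀.domain, (1 + γ₀) * ‖(ψ : 𝓗)‖ ^ 2 ≤ (inner ℂ (ψ : 𝓗) (H₀ ψ)).re)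
    -- `H₁` is self-adjoint and `H₀^{1/2}`-bounded
    (hH₁ : IsSelfAdjoint H₁) (ha : 0 ≤ a) (hb : 0 ≤ b) (hrel : RelBounded H₁ (halfPow H₀ 1) a b)
    -- the condition that fixes the range of the intensity `ε`
    (hεs : 0 < εs)
    (hεs_lt : (3 * γ₀ + 1) / γ₀ * εs * maxAbs g * pnorm (pcomp H₁ (halfPow H₀ (-2))) < 1)
    (n : ℤ)
    -- the commutator assumption for `-|n| ≤ k ≤ -1`
    (K : 𝓗 →ₗ.[ℂ] 𝓗) (E : ℤ → ℝ)
    (hcomm : ∀ k : ℤ, -|n| ≤ k → k ≤ -1 → CommutatorBound H₀ H₁ K g εs k (E k))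
    (ε : ℝ) (hε : 0 < ε) (hε_le : ε ≤ εs) (η : ℝ) (hη : 0 < η)
    (U : ℝ → ℝ → (𝓗 →L[ℂ] 𝓗))
    (hU : IsUnitaryPropagator (hamiltonian H₀ H₁ g ε η) H₀.domain U) (t r : ℝ) :
    NormLE (pcomp (halfPow (hamiltonian H₀ H₁ g ε η t) (-n))
        (pcomp (ofBounded (U t r)) (halfPow (hamiltonian H₀ H₁ g ε η r) n)))
      (energyConst (alphaConst g a b) (betaConst H₀ H₁ g a) (gammaConst g E) ε n.natAbs) := by
  obtain ⟨B₀, W, h, hab, hp, hP⟩ := hrel.exists_perturbationData hγ₀ hH₀ hH₀_ge hH₁ ha hb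
  rcases subsingleton_or_nontrivial 𝓗 with h𝓗 | h𝓗
  · refine ⟨?_, fun ψ => ?_⟩
    · exact fun x => subset_closure ((Subsingleton.elim x 0) ▸ Submodule.zero_mem _)
    · rw [Subsingleton.elim (ψ : 𝓗) 0, norm_zero, mul_zero, norm_le_zero_iff]
      exact Subsingleton.elim _ _
  have hp0 := pnorm_nonneg (pcomp H₁ (halfPow H₀ (-1)))
  have hP0 := pnorm_nonneg (pcomp H₁ (halfPow H₀ (-2)))
  have hM0 := maxAbs_nonneg g
  have hM : ∀ s, |ε * g (η * s)| ≤ ε * maxAbs g := fun s => by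
    rw [abs_mul, abs_of_pos hε]
    gcongr
    exact abs_le_maxAbs hg hg' hg0 _
  -- `δ` bounds `‖ε g H₁ H₀⁻¹‖` uniformly in time
  obtain ⟨δ, hδ⟩ : ∃ δ, δ = εs * maxAbs g * pnorm (pcomp H₁ (halfPow H₀ (-2))) := ⟨_, rfl⟩
  have hδ0 : 0 ≤ δ := by rw [hδ]; positivity
  have hδlt : (3 * γ₀ + 1) / γ₀ * δ < 1 := by
    rw [hδ]
    simpa only [mul_assoc] using hεs_lt
  have hδ1 : δ < 1 := by
    rw [div_mul_eq_mul_div, div_lt_one hγ₀] at hδlt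
    nlinarith
  have hnorm : ∀ s, ‖((ε * g (η * s) : ℝ) : ℂ) • (W * B₀)‖ ≤ δ := fun s => by
    rw [norm_smul, Complex.norm_real, Real.norm_eq_abs, hδ]
    refine mul_le_mul ((hM s).trans (by gcongr)) ?_ (norm_nonneg _) (by positivity)
    exact ContinuousLinearMap.opNorm_le_bound _ hP0 hP
  have hu : ∀ s, IsUnit (1 + ((ε * g (η * s) : ℝ) : ℂ) • (W * B₀)) := fun s =>
    PerturbationData.isUnit W B₀ ((hnorm s).trans_lt hδ1)
  have hex : ∀ s, ∃ B, IsInvSqrt (hamiltonian H₀ H₁ g ε η s) B ∧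
      B ^ 2 = B₀ ^ 2 * Ring.inverse (1 + ((ε * g (η * s) : ℝ) : ℂ) • (W * B₀)) := fun s =>
    (h.isBoundedInverse (hu s)).exists_isInvSqrt (h.symm _) (h.ge_one hγ₀ (hnorm s) hδlt)
  choose B hB hBR using hex
  have hF : ∀ s, FormBounds (B s)
      (W * B₀ * Ring.inverse (1 + ((ε * g (η * s) : ℝ) : ℂ) • (W * B₀)))
      (a + b + a * (3 * ε * maxAbs g * pnorm (pcomp H₁ (halfPow H₀ (-1)))))
      (fun k => E (-(k : ℤ))) n.natAbs := fun s => by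
    refine h.formBounds (K := K) ha hb hab hp (by positivity) ?_ (hu s) (hB s) (hBR s)
      fun k hk hkn => ?_
    · refine mul_le_mul_of_nonneg_right ((hM s).trans ?_) hp0
      nlinarith [mul_nonneg hε.le hM0]
    · have hc := hcomm (-(k : ℤ)) (by rw [Int.abs_eq_natAbs]; omega) (by omega)
      exact ⟨hc.1, hc.2 ε η s hε hε_le hη⟩
  have hB' : ∀ s, HasDerivAt (fun s => B s ^ 2)
      (((-(ε * (deriv g (η * s) * η)) : ℝ) : ℂ) •
        (B s ^ 2 * (W * B₀ * Ring.inverse (1 + ((ε * g (η * s) : ℝ) : ℂ) • (W * B₀))))) s := by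
    intro s
    have h1 : HasDerivAt (fun s => ε * g (η * s)) (ε * (deriv g (η * s) * η)) s := by
      have h2 : HasDerivAt (fun s : ℝ => η * s) η s := by
        simpa using (hasDerivAt_id s).const_mul η
      exact ((hg.differentiable one_ne_zero (η * s)).hasDerivAt.comp s h2).const_mul ε
    simp only [hBR]
    exact PerturbationData.hasDerivAt_resolvent W B₀ h1 (hu s)
  have hC : Real.exp (ε * maxAbs (deriv g) * ∑ j ∈ Finset.range n.natAbs, formConst
      (a + b + a * (3 * ε * maxAbs g * pnorm (pcomp H₁ (halfPow H₀ (-1)))))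
      (fun k => E (-(k : ℤ))) j) ≤
      energyConst (alphaConst g a b) (betaConst H₀ H₁ g a) (gammaConst g E) ε n.natAbs :=
    exp_sum_le_energyConst hε (maxAbs_nonneg _) (by positivity) (hF 0).e_nonneg
      (by rw [alphaConst, betaConst]; ring) (fun k => rfl)
  refine hU.normLE hB ((Real.exp_pos _).le.trans hC) n (fun t r x => ?_) t r
  refine (hU.norm_pow_apply_le hg hg' hε hη hH₀.dense_domain hB hB' hF t r x).trans ?_
  gcongr
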